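/- All Hilbert spaces are finite-dimensional and non-zero. A party $A$ holds an input system $A_0$ and an output system $A_1$; $\mathcal L^A$ is the space of linear maps $\mathcal B(\mathcal H^{A_0})\to\mathcal B(\mathcal H^{A_1})$, bipartite maps in $\mathcal L^{AB}$ go from $\mathcal B(\mathcal H^{A_0}\otimes\mathcal H^{B_0})$ to $\mathcal B(\mathcal H^{A_1}\otimes\mathcal H^{B_1})$, and a channel is a completely positive (CP) trace-preserving (TP) map. A superchannel is a linear map $\Theta:\mathcal L^A\to\mathcal L^B$ such that $\Theta[\Omega]$ is TP whenever $\Omega\in\mathcal L^A$ is TP, and such that, for every system $C=(C_0,C_1)$, $\mathbb 1^C\otimes\Theta$ sends CP maps to CP maps, where $\mathbb 1^C$ is the identity of $\mathcal L^C$. For a CP map $\Omega\in\mathcal L^{AB}$ let $\omega^{AB}=\frac{1}{d_{A_0}d_{B_0}}\sum_{i,j}|i\rangle\langle j|\otimes\Omega(|i\rangle\langle j|)$, with $|i\rangle$ in the product basis of $\mathcal H^{A_0}\otimes\mathcal H^{B_0}$, be its normalized Choi matrix. Its extended conditional min-entropy is $$H_{\min}^{\rm ext}(B|A)_\Omega=-\log_2\min\{{\rm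 Tr}\,\gamma^{A_0A_1B_0}\;:\;\gamma^{A_0A_1B_0}\otimes I^{B_1}\ge\omega^{AB},\ \gamma^{A_0B_0}=\tfrac{1}{d_{A_0}}I^{A_0}\otimes\gamma^{B_0}\},$$ where $\gamma^{A_0A_1B_0}$ is Hermitian, $\gamma^{A_0B_0}$ and $\gamma^{B_0}$ are its partial traces, and $-\log_2 0=+\infty$. Let $\Phi^{RA}\in\mathcal L^{RA}$ and $\Psi^{RB}\in\mathcal L^{RB}$ be channels. Let $\{|\varphi_x\rangle\langle\varphi_x|\}_{x=1}^{d_X}$, with unit vectors $\varphi_x$ and $d_X=d_{R_0}^2$, be a basis of the real space of Hermitian operators on $\mathcal H^{R_0}$, and let $\{E_y\}_{y=1}^{d_Y}$, with $d_Y=d_{R_1}^2$, be a POVM on $\mathcal H^{R_1}$ that is a basis of $\mathcal B(\mathcal H^{R_1})$. Put $$\Phi^A_{y|x}(\rho)={\rm Tr}_{R_1}\big[(E_y\otimes I^{A_1})\,\Phi^{RA}(|\varphi_x\rangle\langle\varphi_x|\otimes\rho)\big],$$ and define $\Psi^B_{y|x}$ in the same way from $\Psi^{RB}$. Let $\mathcal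 C_\star^{XYB}$ be the set of channels of the form $\Lambda^{XYB}=\frac1{d_X}\sum_{x,y}|xy\rangle\langle xy|\otimes\Lambda^B_{y|x}$, with $\Lambda^B_{y|x}\in\mathcal L^B$, such that $\sum_y\Lambda^B_{y|x}$ is a channel for each $x$. For $\Lambda^{XYB}\in\mathcal C_\star^{XYB}$ define the bipartite CP maps $$\Lambda_\Phi^{AB}=\frac1{d_X}\sum_{x,y}\Phi^A_{y|x}\otimes\Lambda^B_{y|x},\qquad \Lambda_\Psi^{\tilde BB}=\frac1{d_X}\sum_{x,y}\Psi^{\tilde B}_{y|x}\otimes\Lambda^B_{y|x},$$ where $\tilde B$ is a copy of $B$. Theorem. There is a superchannel $\Theta:\mathcal L^A\to\mathcal L^B$ with $\Psi^{RB}=(\mathbb 1^R\otimes\Theta)[\Phi^{RA}]$ if and only if, for every $\Lambda^{XYB}\in\mathcal C_\star^{XYB}$, $$H_{\min}^{\rm ext}(B|A)_{\Lambda_\Phi}\le H_{\min}^{\rm ext}(B|\tilde B)_{\Lambda_\Psi}.$$ -/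

import Mathlib

open scoped Kronecker ComplexOrder

noncomputable section

namespace QMaj

/-- Operators on the finite-dimensional Hilbert space with orthonormal basis indexed by `n`. -/
abbrev Op (n : Type*) := Matrix n n ℂ

/-- Linear maps from the operators on system `n` to the operators on system `m`. The composite of
two systems `n`, `m` is `n × m`. -/
abbrev LMap (n m : Type*) := Op n →ₗ[ℂ] Op m

/-! ### Blocks, tensor products and partial traces -/

/-- `X ↦ M ⊗ X`. -/
def kronLeft {R A : Type*} (M : Op R) : LMap A (R × A) where
  toFun X := M ⊗ₖ X
  map_add' X Y := Matrix.kronecker_add M X Y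
  map_smul' c X := Matrix.kronecker_smul c M X

/-- `X ↦ |i⟩⟨j| ⊗ X`. -/
def inBlock {R A : Type*} [DecidableEq R] (i j : R) : LMap A (R × A) :=
  kronLeft (Matrix.single i j 1)

/-- `X ↦ (⟨i| ⊗ I) X (|j⟩ ⊗ I)`. -/
def outBlock {R A : Type*} (i j : R) : LMap (R × A) A where
  toFun X := X.submatrix (fun a => (i, a)) (fun a => (j, a))
  map_add' _ _ := rfl
  map_smul' _ _ := rfl

/-- The tensor product `E ⊗ F` of two linear maps. -/
def tensorMap {A₀ A₁ B₀ B₁ : Type*} [Fintype A₀] [DecidableEq A₀]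
    (E : LMap A₀ A₁) (F : LMap B₀ B₁) : LMap (A₀ × B₀) (A₁ × B₁) :=
  ∑ i, ∑ j, kronLeft (E (Matrix.single i j 1)) ∘ₗ F ∘ₗ outBlock i j

/-- Partial trace over the first system. -/
def traceFst {R A : Type*} [Fintype R] : LMap (R × A) A := ∑ k, outBlock k k

/-- Partial trace over the second system. -/
def traceSnd {A R : Type*} [Fintype R] (X : Op (A × R)) : Op A :=
  Matrix.of fun a a' => ∑ k, X (a, k) (a', k)

/-- The maximally mixed state `u`. -/
def uniformState (A : Type*) [Fintype A] [DecidableEq A] : Op A :=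
  (Fintype.card A : ℂ)⁻¹ • 1

/-! ### Channels -/

/-- Complete positivity: `id ⊗ Φ` preserves positive semidefiniteness for each ancilla `ℂⁿ`. -/
def IsCP {A₀ A₁ : Type*} (Φ : LMap A₀ A₁) : Prop :=
  ∀ (n : ℕ) (ρ : Op (Fin n × A₀)), ρ.PosSemidef →
    (tensorMap (LinearMap.id : LMap (Fin n) (Fin n)) Φ ρ).PosSemidef

/-- Trace preservation. -/
def IsTP {A₀ A₁ : Type*} [Fintype A₀] [Fintype A₁] (Φ : LMap A₀ A₁) : Prop :=
  ∀ ρ : Op A₀, (Φ ρ).trace = ρ.trace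

/-- Quantum channels: completely positive trace-preserving maps. -/
def IsChannel {A₀ A₁ : Type*} [Fintype A₀] [Fintype A₁] (Φ : LMap A₀ A₁) : Prop :=
  IsCP Φ ∧ IsTP Φ

/-! ### Supermaps -/

/-- Linear supermaps, sending linear maps `A₀ → A₁` to linear maps `B₀ → B₁`. -/
abbrev SuperMap (A₀ A₁ B₀ B₁ : Type*) := LMap A₀ A₁ →ₗ[ℂ] LMap B₀ B₁

/-- The canonical components of a bipartite map: with `𝓔(ρ) = ⟨i|ρ|j⟩ |k⟩⟨l|` one has
`Ω = ∑ i j k l, 𝓔 ⊗ component Ω i j k l`. -/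
def component {R₀ R₁ A₀ A₁ : Type*} [DecidableEq R₀]
    (Ω : LMap (R₀ × A₀) (R₁ × A₁)) (i j : R₀) (k l : R₁) : LMap A₀ A₁ :=
  outBlock k l ∘ₗ Ω ∘ₗ inBlock i j

/-- `(𝟙^R ⊗ Θ)[Ω] = ∑ i j k l, 𝓔 ⊗ Θ[component Ω i j k l]`, where
`𝓔(ρ) = ⟨i|ρ|j⟩ |k⟩⟨l|` runs over the canonical basis of the linear maps `R₀ → R₁`. -/
def applySecond {R₀ R₁ A₀ A₁ B₀ B₁ : Type*} [Fintype R₀] [DecidableEq R₀]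
    [Fintype R₁] [DecidableEq R₁] (Θ : SuperMap A₀ A₁ B₀ B₁)
    (Ω : LMap (R₀ × A₀) (R₁ × A₁)) : LMap (R₀ × B₀) (R₁ × B₁) :=
  ∑ i, ∑ j, ∑ k, ∑ l, inBlock k l ∘ₗ Θ (component Ω i j k l) ∘ₗ outBlock i j

/-- Completely CP preserving: `𝟙^C ⊗ Θ` sends CP maps to CP maps for all dimensions of
`C = (C₀, C₁)`. -/
def IsCompletelyCPP {A₀ A₁ B₀ B₁ : Type*} (Θ : SuperMap A₀ A₁ B₀ B₁) : Prop :=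
  ∀ (c₀ c₁ : ℕ) (Ω : LMap (Fin c₀ × A₀) (Fin c₁ × A₁)), IsCP Ω → IsCP (applySecond Θ Ω)

/-- TP preserving. -/
def IsTPP {A₀ A₁ B₀ B₁ : Type*} [Fintype A₀] [Fintype A₁] [Fintype B₀] [Fintype B₁]
    (Θ : SuperMap A₀ A₁ B₀ B₁) : Prop :=
  ∀ Ω : LMap A₀ A₁, IsTP Ω → IsTP (Θ Ω)

/-- Superchannels. -/
def IsSuperchannel {A₀ A₁ B₀ B₁ : Type*} [Fintype A₀] [Fintype A₁] [Fintype B₀] [Fintype B₁]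
    (Θ : SuperMap A₀ A₁ B₀ B₁) : Prop :=
  IsCompletelyCPP Θ ∧ IsTPP Θ

/-- `Φ^{RA}` quantum majorizes `Ψ^{RB}`: `Ψ = (𝟙^R ⊗ Θ)[Φ]` for some superchannel `Θ`. -/
def QuantumMajorizes {R₀ R₁ A₀ A₁ B₀ B₁ : Type*} [Fintype R₀] [DecidableEq R₀]
    [Fintype R₁] [DecidableEq R₁] [Fintype A₀] [Fintype A₁] [Fintype B₀] [Fintype B₁]
    (Φ : LMap (R₀ × A₀) (R₁ × A₁)) (Ψ : LMap (R₀ × B₀) (R₁ × B₁)) : Prop :=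
  ∃ Θ : SuperMap A₀ A₁ B₀ B₁, IsSuperchannel Θ ∧ Ψ = applySecond Θ Φ

/-! ### The extended conditional min-entropy -/

/-- The (unnormalized) Choi matrix `(id ⊗ Φ)(φ₊) = ∑ i j, |i⟩⟨j| ⊗ Φ(|i⟩⟨j|)`. -/
def choi {A₀ A₁ : Type*} [DecidableEq A₀] (Φ : LMap A₀ A₁) : Op (A₀ × A₁) :=
  Matrix.of fun p q => Φ (Matrix.single p.1 q.1 1) p.2 q.2

section Entropy

variable {A₀ A₁ B₀ B₁ : Type*} [Fintype A₀] [DecidableEq A₀] [Fintype A₁]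
  [Fintype B₀] [DecidableEq B₀] [DecidableEq B₁]

/-- The normalized Choi matrix `ω^{AB}` of a bipartite map. -/
def normChoi (Ω : LMap (A₀ × B₀) (A₁ × B₁)) : Op ((A₀ × B₀) × (A₁ × B₁)) :=
  ((Fintype.card A₀ : ℂ) * (Fintype.card B₀ : ℂ))⁻¹ • choi Ω

/-- `γ^{AB₀}` (on the systems `A₀, B₀, A₁` in this order) is feasible: it is Hermitian,
`γ^{AB₀} ⊗ I^{B₁} ≥ ω^{AB}`, and `γ^{A₀B₀} = u^{A₀} ⊗ γ^{B₀}`. -/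
def IsFeasible (Ω : LMap (A₀ × B₀) (A₁ × B₁)) (γ : Op ((A₀ × B₀) × A₁)) : Prop :=
  γ.IsHermitian ∧
  ((γ ⊗ₖ (1 : Op B₁)).submatrix (Equiv.prodAssoc (A₀ × B₀) A₁ B₁).symm
      (Equiv.prodAssoc (A₀ × B₀) A₁ B₁).symm - normChoi Ω).PosSemidef ∧
  traceSnd γ = uniformState A₀ ⊗ₖ traceFst (traceSnd γ)

/-- The minimum of `Tr γ^{AB₀}` over feasible `γ^{AB₀}`. -/
def minTrace (Ω : LMap (A₀ × B₀) (A₁ × B₁)) : ℝ :=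
  sInf {t : ℝ | ∃ γ : Op ((A₀ × B₀) × A₁), IsFeasible Ω γ ∧ t = γ.trace.re}

/-- The extended conditional min-entropy `H_min^ext(B|A)_Ω = -log₂ min Tr γ`, where
`-log₂ 0 = +∞` (the minimum vanishes exactly for the zero CP map). -/
def Hminext (Ω : LMap (A₀ × B₀) (A₁ × B₁)) : EReal :=
  if minTrace Ω = 0 then ⊤ else ((-Real.logb 2 (minTrace Ω) : ℝ) : EReal)

end Entropy

/-! ### Classical reductions -/

/-- `{|φ_x⟩⟨φ_x|}` is a normalized rank-one basis of the real space of Hermitian operators. -/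
def IsRankOneBasis {R X : Type*} [Fintype R] (φ : X → R → ℂ) : Prop :=
  (∀ x, star (φ x) ⬝ᵥ φ x = 1) ∧
  LinearIndependent ℝ (fun x => Matrix.vecMulVec (φ x) (star (φ x))) ∧
  Submodule.span ℝ (Set.range fun x => Matrix.vecMulVec (φ x) (star (φ x))) =
    selfAdjoint.submodule ℝ (Op R)

/-- `{E_y}` is an informationally complete POVM whose elements form a basis. -/
def IsBasisPOVM {R Y : Type*} [Fintype R] [DecidableEq R] [Fintype Y] (E : Y → Op R) : Prop :=
  (∀ y, (E y).PosSemidef) ∧ ∑ y, E y = 1 ∧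
  LinearIndependent ℂ E ∧ Submodule.span ℂ (Set.range E) = ⊤

/-- `Φ_{y|x}(ρ) = Tr_{R₁}[(E_y ⊗ I) Φ(|φ_x⟩⟨φ_x| ⊗ ρ)]`. -/
def reduction {R₀ R₁ A₀ A₁ X Y : Type*} [Fintype R₁] [Fintype A₁] [DecidableEq A₁]
    (φ : X → R₀ → ℂ) (E : Y → Op R₁)
    (Φ : LMap (R₀ × A₀) (R₁ × A₁)) (x : X) (y : Y) : LMap A₀ A₁ :=
  traceFst ∘ₗ LinearMap.mulLeft ℂ (E y ⊗ₖ (1 : Op A₁)) ∘ₗ Φ ∘ₗ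
    kronLeft (Matrix.vecMulVec (φ x) (star (φ x)))

/-- The map `(1/d_X) ∑ x y, |xy⟩⟨xy|^{XY} ⊗ Λ_{y|x}`, where `X`, `Y` are classical with
trivial input. The family `Λ_{y|x}` can be recovered from it. -/
def cqMap {X Y B₀ B₁ : Type*} [Fintype X] [DecidableEq X] [Fintype Y] [DecidableEq Y]
    (Λ : X → Y → LMap B₀ B₁) : LMap B₀ ((X × Y) × B₁) :=
  (Fintype.card X : ℂ)⁻¹ • ∑ x, ∑ y, inBlock (x, y) (x, y) ∘ₗ Λ x y

/-- The classical–quantum map `Λ^{XYB}` with components `Λ_{y|x}` belongs to `𝓒_⋆`: it is a quantum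
channel and, for each `x`, `∑ y, Λ_{y|x}` is a quantum channel. -/
def InCStar {X Y B₀ B₁ : Type*} [Fintype X] [DecidableEq X] [Fintype Y] [DecidableEq Y]
    [Fintype B₀] [Fintype B₁] (Λ : X → Y → LMap B₀ B₁) : Prop :=
  IsChannel (cqMap Λ) ∧ ∀ x, IsChannel (∑ y, Λ x y)

/-- `Λ_Φ = (1/d_X) ∑ x y, Φ_{y|x} ⊗ Λ_{y|x}`. -/
def pairing {X Y A₀ A₁ B₀ B₁ : Type*} [Fintype X] [Fintype Y] [Fintype A₀] [DecidableEq A₀]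
    (Φ : X → Y → LMap A₀ A₁) (Λ : X → Y → LMap B₀ B₁) : LMap (A₀ × B₀) (A₁ × B₁) :=
  (Fintype.card X : ℂ)⁻¹ • ∑ x, ∑ y, tensorMap (Φ x y) (Λ x y)

end QMaj

end

set_option linter.unusedSectionVars false

open scoped Kronecker ComplexOrder

noncomputable section

/-! Call an operator on $A_0B_0A_1$ balanced if its marginal on $A_0B_0$ is $u^{A_0}\otimes\tau$.
Let $N(W)$ (`minTraceOf`) be the least trace of a balanced Hermitian $\gamma$ with $\gamma\otimes
I\ge W$. Entropy inequalities are reversed inequalities between values of $N$ at normalized Choi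
matrices.

Monotonicity: a superchannel $\Theta$ carries a feasible $\gamma$ for $\Lambda_\Phi$ to one of equal
trace for $\Lambda_\Psi$. Positivity of the Choi matrix of $\Theta$ preserves the domination, and
preservation of TP maps preserves balance (`Dominates.pushforward`, `minTrace_supermap_le`).

Converse: write $F,G$ for the reductions of $\Phi,\Psi$. Testing feasibility for $\Lambda_\Psi$
against the maximally entangled vector on $\tilde BB$ bounds its value of $N$ below by a multiple of
$\sum\langle\Lambda_{y|x},G_{y|x}\rangle$, where the pairing is of Choi matrices
(`Dominates.le_trace_of_self`). The hypothesis then gives $d_{A_0}\sum\langle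
W_{xy},G_{y|x}\rangle\le N(\sum F_{y|x}\otimes W_{xy})$ for normalized positive families $W$. Adding
$Z_x\otimes I$ to $W_{xy}$ raises the left side by $d_{A_0}\sum{\rm Tr}\,Z_x$ and the right side by
at most that, so the bound extends to all Hermitian families (`choiPair_le_of_isHermitian`).

Since $N$ is sublinear, Hahn–Banach extends the left side, as a functional of $\sum F\otimes W$, to
a real functional $g\le N$ on all operators, with $N$ evaluated at Hermitian parts. Such a $g$ is
positive and equals the trace on $\gamma\otimes I$ for balanced $\gamma$; these are the two defining
properties of a superchannel (`isSuperchannel_toSuperMap`). Agreement with the pairing on product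
terms forces $\Theta[F_{y|x}]=G_{y|x}$, and the reductions determine the bipartite map
(`reduction_injective`). -/

open Matrix in
/-- Contraction of a positive semidefinite matrix is positive semidefinite. -/
theorem Matrix.PosSemidef.contract {n m ι : Type*} [Fintype n] [Fintype m] [Fintype ι]
    {X : Matrix n n ℂ} (hX : X.PosSemidef) (f : m → ι → n) :
    (Matrix.of fun a b => ∑ i, ∑ j, X (f a i) (f b j)).PosSemidef := by
  classical
  have h := hX.conjTranspose_mul_mul_same
    (Matrix.of fun p a => ∑ i, if p = f a i then (1 : ℂ) else 0)
  convert h using 1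
  ext a b
  have key : ∀ (g : n → ℂ) (b : m), ∑ p, g p * ∑ i, (if p = f b i then (1 : ℂ) else 0) =
      ∑ i, g (f b i) := by
    intro g b
    simp_rw [Finset.mul_sum]
    rw [Finset.sum_comm]
    simp
  have key' : ∀ (g : n → ℂ) (b : m), ∑ p, star (∑ i, (if p = f b i then (1 : ℂ) else 0)) * g p =
      ∑ i, g (f b i) := by
    intro g b
    rw [← key]
    refine Finset.sum_congr rfl fun p _ => ?_
    simp [mul_comm]
  simp only [mul_apply, of_apply, conjTranspose_apply, key, key']
  rw [Finset.sum_comm]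

namespace QMaj

/-! ### Choi matrices and the Choi criteria for CP and TP maps. -/

section Choi

variable {A₀ A₁ B₀ B₁ : Type*} [DecidableEq A₀] [DecidableEq B₀]

theorem kronLeft_apply {R A : Type*} (M : Op R) (X : Op A) (p q : R × A) :
    kronLeft M X p q = M p.1 q.1 * X p.2 q.2 := rfl

theorem outBlock_apply {R A : Type*} (i j : R) (X : Op (R × A)) (a b : A) :
    outBlock i j X a b = X (i, a) (j, b) := rfl

theorem outBlock_single (i j : A₀) (a a' : A₀) (b b' : B₀) :
    outBlock i j (Matrix.single (a, b) (a', b') (1 : ℂ)) =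
      if i = a ∧ j = a' then Matrix.single b b' 1 else 0 := by
  ext k l
  simp only [outBlock_apply, Matrix.single_apply, Prod.mk.injEq]
  split_ifs <;> simp_all

theorem inBlock_single (i j : A₀) (b b' : B₀) :
    inBlock i j (Matrix.single b b' (1 : ℂ)) = Matrix.single (i, b) (j, b') 1 := by
  ext ⟨p, q⟩ ⟨p', q'⟩
  simp only [inBlock, kronLeft_apply, Matrix.single_apply, Prod.mk.injEq]
  split_ifs <;> simp_all

theorem choi_add (Ω Ω' : LMap A₀ A₁) : choi (Ω + Ω') = choi Ω + choi Ω' := rfl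

theorem choi_smul (c : ℂ) (Ω : LMap A₀ A₁) : choi (c • Ω) = c • choi Ω := rfl

theorem choi_sum {ι : Type*} (s : Finset ι) (Ω : ι → LMap A₀ A₁) :
    choi (∑ i ∈ s, Ω i) = ∑ i ∈ s, choi (Ω i) := by
  ext p q; simp [choi, Matrix.sum_apply]


variable [Fintype A₀]

theorem sum_single_smul (ρ : Op A₀) :
    ρ = ∑ i, ∑ j, ρ i j • (Matrix.single i j 1 : Op A₀) := by
  conv_lhs => rw [Matrix.matrix_eq_sum_single ρ]
  simp [Matrix.smul_single]

theorem apply_eq_sum_choi (Ω : LMap A₀ A₁) (ρ : Op A₀) (k l : A₁) :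
    Ω ρ k l = ∑ i, ∑ j, ρ i j * choi Ω (i, k) (j, l) := by
  conv_lhs => rw [sum_single_smul ρ]
  simp only [map_sum, map_smul, Matrix.sum_apply, Matrix.smul_apply, smul_eq_mul, choi,
    Matrix.of_apply]

theorem choi_injective : Function.Injective (choi : LMap A₀ A₁ → Op (A₀ × A₁)) := by
  intro Ω Ω' h
  ext ρ k l
  rw [apply_eq_sum_choi, apply_eq_sum_choi, h]

/-- The linear map with a given Choi matrix. -/
def ofChoi (C : Op (A₀ × A₁)) : LMap A₀ A₁ where
  toFun ρ := Matrix.of fun k l => ∑ i, ∑ j, ρ i j * C (i, k) (j, l)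
  map_add' ρ σ := by
    ext k l; simp [add_mul, Finset.sum_add_distrib]
  map_smul' c ρ := by
    ext k l; simp [mul_assoc, Finset.mul_sum]

theorem choi_ofChoi (C : Op (A₀ × A₁)) : choi (ofChoi C) = C := by
  ext p q
  simp only [choi, ofChoi, Matrix.of_apply, LinearMap.coe_mk, AddHom.coe_mk, Matrix.single_apply]
  rw [Finset.sum_eq_single p.1 (by intro b _ hb; simp [hb.symm]) (by simp),
    Finset.sum_eq_single q.1 (by intro b _ hb; simp [hb.symm]) (by simp)]
  simp

theorem choi_tensorMap (E : LMap A₀ A₁) (F : LMap B₀ B₁) :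
    choi (tensorMap E F) = (choi E ⊗ₖ choi F).submatrix
      (Equiv.prodProdProdComm A₀ B₀ A₁ B₁) (Equiv.prodProdProdComm A₀ B₀ A₁ B₁) := by
  ext ⟨⟨a, b⟩, c, d⟩ ⟨⟨a', b'⟩, c', d'⟩
  simp only [choi, tensorMap, Matrix.of_apply, LinearMap.sum_apply, LinearMap.comp_apply, outBlock_single,
    Matrix.sum_apply]
  rw [Finset.sum_eq_single a (by intros; simp_all [kronLeft_apply]) (by simp),
    Finset.sum_eq_single a' (by intros; simp_all [kronLeft_apply]) (by simp)]
  simp [kronLeft_apply, Equiv.prodProdProdComm]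

/-- Choi's theorem. -/
theorem isCP_iff [Fintype A₁] (Ω : LMap A₀ A₁) : IsCP Ω ↔ (choi Ω).PosSemidef := by
  classical
  have key : ∀ (n : ℕ) (ρ : Op (Fin n × A₀)) (k l : A₁) (a b : Fin n),
      tensorMap (LinearMap.id : LMap (Fin n) (Fin n)) Ω ρ (a, k) (b, l) =
        ∑ i, ∑ j, ρ (a, i) (b, j) * choi Ω (i, k) (j, l) := by
    intro n ρ k l a b
    simp only [tensorMap, LinearMap.sum_apply, LinearMap.comp_apply, Matrix.sum_apply,
      LinearMap.id_apply]
    rw [Finset.sum_eq_single a (by intros; simp_all [kronLeft_apply]) (by simp),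
      Finset.sum_eq_single b (by intros; simp_all [kronLeft_apply]) (by simp)]
    simp only [kronLeft, LinearMap.coe_mk, AddHom.coe_mk, Matrix.kronecker_apply,
      Matrix.single_apply_same, one_mul, apply_eq_sum_choi Ω]
    rfl
  constructor
  · intro h
    -- The ancilla is a copy of $A_0$, and the input below is the unnormalized maximally entangled
    -- state, whose image is the Choi matrix.
    let e := Fintype.equivFin A₀
    have h1 := h _ _ (Matrix.posSemidef_vecMulVec_self_star
      (fun p : Fin (Fintype.card A₀) × A₀ => if p.1 = e p.2 then (1 : ℂ) else 0))
    have h2 := h1.submatrix (fun p : A₀ × A₁ => (e p.1, p.2))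
    convert h2 using 1
    ext ⟨i, k⟩ ⟨j, l⟩
    simp only [Matrix.submatrix_apply, key]
    simp [Matrix.vecMulVec_apply]
  · intro h n ρ hρ
    convert (hρ.kronecker h).contract
      (fun (a : Fin n × A₁) (i : A₀) => ((a.1, i), (i, a.2))) using 1
    ext ⟨a, k⟩ ⟨b, l⟩
    simp [key]

theorem isTP_iff [Fintype A₁] (Ω : LMap A₀ A₁) : IsTP Ω ↔ traceSnd (choi Ω) = 1 := by
  have key : ∀ ρ, (Ω ρ).trace = ∑ i, ∑ j, ρ i j * traceSnd (choi Ω) i j := by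
    intro ρ
    simp only [Matrix.trace, Matrix.diag, apply_eq_sum_choi Ω, traceSnd, Matrix.of_apply,
      Finset.mul_sum]
    rw [Finset.sum_comm]
    refine Finset.sum_congr rfl fun i _ => ?_
    rw [Finset.sum_comm]
  constructor
  · intro h
    ext i j
    have := h (Matrix.single i j 1)
    rw [Matrix.trace] at this
    simp only [traceSnd, Matrix.of_apply, choi]
    rw [Matrix.one_apply]
    simpa [Matrix.trace, Matrix.diag, Matrix.single_apply, Finset.sum_ite, eq_comm, ite_and]
      using this
  · intro h ρ
    rw [key, h]
    simp [Matrix.one_apply, Matrix.trace]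

theorem choi_component {R₀ R₁ : Type*} [DecidableEq R₀]
    (Ω : LMap (R₀ × A₀) (R₁ × A₁)) (i j : R₀) (k l : R₁) (p q : A₀ × A₁) :
    choi (component Ω i j k l) p q = choi Ω ((i, p.1), (k, p.2)) ((j, q.1), (l, q.2)) := by
  simp [choi, component, inBlock_single, outBlock_apply]

theorem choi_applySecond {R₀ R₁ : Type*} [Fintype R₀] [DecidableEq R₀]
    [Fintype R₁] [DecidableEq R₁]
    (Θ : SuperMap A₀ A₁ B₀ B₁) (Ω : LMap (R₀ × A₀) (R₁ × A₁)) (p q : (R₀ × B₀) × (R₁ × B₁)) :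
    choi (applySecond Θ Ω) p q = choi (Θ (component Ω p.1.1 q.1.1 p.2.1 q.2.1))
      (p.1.2, p.2.2) (q.1.2, q.2.2) := by
  obtain ⟨⟨a, b⟩, c, d⟩ := p
  obtain ⟨⟨a', b'⟩, c', d'⟩ := q
  simp only [choi, applySecond, Matrix.of_apply, LinearMap.sum_apply, LinearMap.comp_apply, outBlock_single,
    Matrix.sum_apply]
  rw [Finset.sum_eq_single a (by intros; simp_all) (by simp),
    Finset.sum_eq_single a' (by intros; simp_all) (by simp),
    Finset.sum_eq_single c (by intros; simp_all [inBlock, kronLeft_apply]) (by simp),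
    Finset.sum_eq_single c' (by intros; simp_all [inBlock, kronLeft_apply]) (by simp)]
  simp [inBlock, kronLeft_apply]

end Choi

/-! ### Choi matrices of supermaps. -/

section Super

variable {A₀ A₁ B₀ B₁ : Type*} [Fintype A₀] [DecidableEq A₀] [Fintype A₁] [DecidableEq A₁]
  [Fintype B₀] [DecidableEq B₀] [Fintype B₁] [DecidableEq B₁]

/-- The Choi matrix of a supermap. -/
def superChoi (Θ : SuperMap A₀ A₁ B₀ B₁) : Op ((A₀ × A₁) × (B₀ × B₁)) :=
  Matrix.of fun p q => choi (Θ (ofChoi (Matrix.single p.1 q.1 1))) p.2 q.2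

theorem eq_sum_choi_smul (Ω : LMap A₀ A₁) :
    Ω = ∑ p, ∑ q, choi Ω p q • ofChoi (Matrix.single p q 1) := by
  apply choi_injective
  simp only [choi_sum, choi_smul, choi_ofChoi]
  exact sum_single_smul _

theorem choi_supermap_apply (Θ : SuperMap A₀ A₁ B₀ B₁) (Ω : LMap A₀ A₁) (s t : B₀ × B₁) :
    choi (Θ Ω) s t = ∑ p, ∑ q, choi Ω p q * superChoi Θ (p, s) (q, t) := by
  conv_lhs => rw [eq_sum_choi_smul Ω]
  simp only [map_sum, map_smul, choi_sum, choi_smul, Matrix.sum_apply, Matrix.smul_apply,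
    smul_eq_mul, superChoi, Matrix.of_apply]

/-- Take $C$ to be a copy of $A$ and apply $\mathbb 1^C\otimes\Theta$ to the CP map whose Choi
matrix is the maximally entangled projector (unnormalized) between $C$ and $A$: the Choi matrix of
the image is `superChoi Θ` up to relabelling. -/
theorem superChoi_posSemidef {Θ : SuperMap A₀ A₁ B₀ B₁} (h : IsCompletelyCPP Θ) :
    (superChoi Θ).PosSemidef := by
  let e := Fintype.equivFin A₀
  let f := Fintype.equivFin A₁
  let v : (Fin (Fintype.card A₀) × A₀) × (Fin (Fintype.card A₁) × A₁) → ℂ :=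
    fun p => if p.1.1 = e p.1.2 ∧ p.2.1 = f p.2.2 then 1 else 0
  have h1 := h _ _ (ofChoi (Matrix.vecMulVec v (star v)))
    ((isCP_iff _).2 (by rw [choi_ofChoi]; exact Matrix.posSemidef_vecMulVec_self_star v))
  rw [isCP_iff] at h1
  convert h1.submatrix (fun p : (A₀ × A₁) × (B₀ × B₁) => ((e p.1.1, p.2.1), (f p.1.2, p.2.2)))
    using 1
  ext ⟨p, s⟩ ⟨q, t⟩
  simp only [Matrix.submatrix_apply, choi_applySecond, superChoi, Matrix.of_apply]
  congr 3
  apply choi_injective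
  ext p' q'
  rw [choi_component, choi_ofChoi, choi_ofChoi]
  simp only [v, Matrix.vecMulVec_apply, Matrix.single_apply, Pi.star_apply,
    EmbeddingLike.apply_eq_iff_eq, Prod.ext_iff]
  split_ifs <;> simp_all

/-- The output Choi matrix is the link product of the input one with `superChoi Θ`, that is, a
contraction of a Kronecker product of positive matrices. -/
theorem isCompletelyCPP_of_superChoi {Θ : SuperMap A₀ A₁ B₀ B₁} (h : (superChoi Θ).PosSemidef) :
    IsCompletelyCPP Θ := by
  intro c₀ c₁ Ω hΩ
  rw [isCP_iff] at hΩ ⊢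
  convert (hΩ.kronecker h).contract (fun (a : (Fin c₀ × B₀) × (Fin c₁ × B₁)) (i : A₀ × A₁) =>
    (((a.1.1, i.1), (a.2.1, i.2)), (i, (a.1.2, a.2.2)))) using 1
  ext p q
  simp only [choi_applySecond, choi_supermap_apply, choi_component]
  rfl

theorem traceSnd_add {n m : Type*} [Fintype m] (X Y : Op (n × m)) :
    traceSnd (X + Y) = traceSnd X + traceSnd Y := by
  ext; simp [traceSnd, Finset.sum_add_distrib]

theorem traceSnd_smul {n m : Type*} [Fintype m] (c : ℂ) (X : Op (n × m)) :
    traceSnd (c • X) = c • traceSnd X := by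
  ext; simp [traceSnd, Finset.mul_sum]

/-- Correcting by a fixed TP map $T$ makes $\Omega+(1-c)T$ TP, and linearity of $\Theta$ does the
rest. No division by $c$ occurs, so $c=0$ and complex $c$ are covered; balanced operators need this
generality. -/
theorem IsTPP.traceSnd_choi [Nonempty A₁] {Θ : SuperMap A₀ A₁ B₀ B₁} (h : IsTPP Θ)
    {Ω : LMap A₀ A₁} {c : ℂ} (hΩ : traceSnd (choi Ω) = c • 1) :
    traceSnd (choi (Θ Ω)) = c • 1 := by
  obtain ⟨k⟩ := ‹Nonempty A₁›
  let T : LMap A₀ A₁ := ofChoi (1 ⊗ₖ Matrix.single k k 1)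
  have hT : IsTP T := by
    rw [isTP_iff, choi_ofChoi]
    ext i j
    simp [traceSnd, Matrix.single_apply]
  have h1 : IsTP (Ω + (1 - c) • T) := by
    rw [isTP_iff] at hT ⊢
    rw [choi_add, choi_smul, traceSnd_add, traceSnd_smul, hΩ, hT, ← add_smul]
    simp
  have h2 := (isTP_iff _).1 (h _ h1)
  have h3 := (isTP_iff _).1 (h _ hT)
  rw [map_add, map_smul, choi_add, choi_smul, traceSnd_add, traceSnd_smul, h3] at h2
  rw [eq_sub_of_add_eq h2, sub_smul, one_smul]
  abel

end Super

/-! ### Classical reductions of a bipartite map. -/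

section Reduction

variable {R₀ R₁ A₀ A₁ B₀ B₁ X Y : Type*} [Fintype R₀] [DecidableEq R₀] [Fintype R₁] [DecidableEq R₁]
  [Fintype A₀] [DecidableEq A₀] [Fintype A₁] [DecidableEq A₁]
  [Fintype B₀] [DecidableEq B₀] [Fintype B₁] [DecidableEq B₁]

theorem reduction_eq_sum (φ : X → R₀ → ℂ) (E : Y → Op R₁) (Φ : LMap (R₀ × A₀) (R₁ × A₁))
    (x : X) (y : Y) :
    reduction φ E Φ x y = ∑ r : R₀ × R₁, ∑ r' : R₀ × R₁,
      (Matrix.vecMulVec (φ x) (star (φ x)) ⊗ₖ (E y).transpose) r r' •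
        component Φ r.1 r'.1 r.2 r'.2 := by
  apply LinearMap.ext
  intro ρ
  ext k l
  have hK : kronLeft (Matrix.vecMulVec (φ x) (star (φ x))) ρ =
      ∑ i, ∑ j, Matrix.vecMulVec (φ x) (star (φ x)) i j • inBlock i j ρ := by
    ext ⟨a, b⟩ ⟨a', b'⟩
    simp [inBlock, kronLeft_apply, Matrix.sum_apply, Matrix.single_apply, ite_and]
  simp only [reduction, LinearMap.comp_apply, hK, map_sum, map_smul, traceFst, LinearMap.sum_apply,
    Matrix.sum_apply, Matrix.smul_apply, outBlock_apply, LinearMap.mulLeft_apply, Matrix.mul_apply,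
    component, LinearMap.smul_apply, Fintype.sum_prod_type, Matrix.kronecker_apply,
    Matrix.one_apply, mul_ite, mul_one, mul_zero, ite_mul, zero_mul, Finset.sum_ite_eq,
    Finset.mem_univ, if_true, smul_eq_mul, Matrix.transpose_apply, Finset.mul_sum]
  refine Finset.sum_congr rfl fun i _ => ?_
  simp only [Finset.sum_comm (s := (Finset.univ : Finset R₀)) (t := (Finset.univ : Finset R₁))]
  rw [Finset.sum_comm]
  refine Finset.sum_congr rfl fun j _ => Finset.sum_congr rfl fun k _ =>
    Finset.sum_congr rfl fun l _ => ?_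
  ring

theorem choi_reduction_posSemidef (φ : X → R₀ → ℂ) {E : Y → Op R₁} (hE : ∀ y, (E y).PosSemidef)
    {Φ : LMap (R₀ × A₀) (R₁ × A₁)} (hΦ : IsCP Φ) (x : X) (y : Y) :
    (choi (reduction φ E Φ x y)).PosSemidef := by
  rw [isCP_iff] at hΦ
  convert ((((Matrix.posSemidef_vecMulVec_self_star (φ x)).kronecker
    (hE y).transpose)).kronecker hΦ).contract
    (fun (p : A₀ × A₁) (r : R₀ × R₁) => (r, ((r.1, p.1), (r.2, p.2)))) using 1
  ext p q
  simp only [reduction_eq_sum, choi_sum, choi_smul, Matrix.sum_apply, Matrix.smul_apply,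
    choi_component, smul_eq_mul, Matrix.of_apply, Matrix.kronecker_apply]

/-- A reduction is a fixed linear combination of components, on each of which $\mathbb
1^R\otimes\Theta$ acts as $\Theta$. -/
theorem reduction_applySecond (φ : X → R₀ → ℂ) (E : Y → Op R₁) (Φ : LMap (R₀ × A₀) (R₁ × A₁))
    (Θ : SuperMap A₀ A₁ B₀ B₁) (x : X) (y : Y) :
    reduction φ E (applySecond Θ Φ) x y = Θ (reduction φ E Φ x y) := by
  simp only [reduction_eq_sum, map_sum, map_smul]
  congr! with r _ r' _
  apply choi_injective
  ext p q
  rw [choi_component, choi_applySecond]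

theorem isTP_sum_reduction [Fintype Y] {φ : X → R₀ → ℂ} (hφ : ∀ x, star (φ x) ⬝ᵥ φ x = 1)
    {E : Y → Op R₁} (hE : ∑ y, E y = 1) {Φ : LMap (R₀ × A₀) (R₁ × A₁)} (hΦ : IsTP Φ) (x : X) :
    IsTP (∑ y, reduction φ E Φ x y) := by
  intro ρ
  have h : (∑ y, reduction φ E Φ x y) ρ =
      traceFst (Φ (kronLeft (Matrix.vecMulVec (φ x) (star (φ x))) ρ)) := by
    simp only [reduction, LinearMap.sum_apply, LinearMap.comp_apply, LinearMap.mulLeft_apply]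
    rw [← map_sum, ← Finset.sum_mul]
    have : ∑ y, E y ⊗ₖ (1 : Op A₁) = 1 := by
      rw [← Matrix.one_kronecker_one, ← hE]
      ext p q
      simp [Matrix.sum_apply, Finset.sum_mul]
    rw [this, one_mul]
  have htr : ∀ Z : Op (R₁ × A₁), (traceFst Z).trace = Z.trace := by
    intro Z
    simp only [Matrix.trace, Matrix.diag, traceFst, LinearMap.sum_apply, Matrix.sum_apply,
      outBlock_apply, Fintype.sum_prod_type]
    rw [Finset.sum_comm]
  rw [h, htr, hΦ]
  simp only [Matrix.trace, Matrix.diag, kronLeft_apply, Fintype.sum_prod_type, ← Finset.mul_sum,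
    ← Finset.sum_mul, Matrix.vecMulVec_apply]
  have := hφ x
  simp only [dotProduct] at this
  simp_rw [mul_comm (φ x _)]
  rw [this, one_mul]

theorem IsRankOneBasis.span_complex {φ : X → R₀ → ℂ} (hφ : IsRankOneBasis φ) :
    Submodule.span ℂ (Set.range fun x => Matrix.vecMulVec (φ x) (star (φ x))) = ⊤ := by
  rw [eq_top_iff]
  intro M _
  have h : ∀ H : Op R₀, IsSelfAdjoint H →
      H ∈ Submodule.span ℂ (Set.range fun x => Matrix.vecMulVec (φ x) (star (φ x))) := by
    intro H hH
    apply Submodule.span_subset_span ℝ ℂ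
    rw [hφ.2.2]
    exact hH
  rw [← realPart_add_I_smul_imaginaryPart M]
  exact add_mem (h _ (realPart M).2) (Submodule.smul_mem _ _ (h _ (imaginaryPart M).2))

theorem component_sub (Φ Φ' : LMap (R₀ × A₀) (R₁ × A₁)) (i j : R₀) (k l : R₁) :
    component (Φ - Φ') i j k l = component Φ i j k l - component Φ' i j k l := by
  simp only [component, LinearMap.sub_comp, LinearMap.comp_sub]

/-- The reductions are the values of a bilinear map at the pairs
$(|\varphi_x\rangle\langle\varphi_x|,E_y)$. Both families span over $\mathbb C$, so the map for the
difference vanishes, and evaluating it at matrix units kills every component. -/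
theorem reduction_injective {φ : X → R₀ → ℂ} (hφ : IsRankOneBasis φ) {E : Y → Op R₁}
    (hE : Submodule.span ℂ (Set.range E) = ⊤) {Φ Φ' : LMap (R₀ × A₀) (R₁ × A₁)}
    (h : ∀ x y, reduction φ E Φ x y = reduction φ E Φ' x y) : Φ = Φ' := by
  let F : Op R₀ →ₗ[ℂ] Op R₁ →ₗ[ℂ] LMap A₀ A₁ := LinearMap.mk₂ ℂ
    (fun M N => ∑ r : R₀ × R₁, ∑ r' : R₀ × R₁, (M r.1 r'.1 * N r'.2 r.2) •
      component (Φ - Φ') r.1 r'.1 r.2 r'.2)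
    (by intros; simp [add_mul, add_smul, Finset.sum_add_distrib])
    (by intros; simp [mul_smul, Finset.smul_sum])
    (by intros; simp [mul_add, add_smul, Finset.sum_add_distrib])
    (by
      intro c M N
      simp only [Finset.smul_sum, smul_smul, Matrix.smul_apply, smul_eq_mul]
      simp only [mul_left_comm c])
  have hF : F = 0 := by
    refine LinearMap.ext_on_range hφ.span_complex fun x => LinearMap.ext_on_range hE fun y => ?_
    have := sub_eq_zero.2 (h x y)
    rw [reduction_eq_sum, reduction_eq_sum] at this
    simp only [F, LinearMap.mk₂_apply, component_sub, smul_sub, Finset.sum_sub_distrib]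
    exact this
  have hc : ∀ (a a' : R₀) (b b' : R₁), component (Φ - Φ') a a' b b' = 0 := by
    intro a a' b b'
    have := LinearMap.congr_fun₂ hF (Matrix.single a a' 1) (Matrix.single b' b 1)
    simpa [F, Fintype.sum_prod_type, Matrix.single_apply, ite_and] using this
  rw [← sub_eq_zero]
  apply choi_injective
  ext ⟨⟨a, b⟩, c, d⟩ ⟨⟨a', b'⟩, c', d'⟩
  have := choi_component (Φ - Φ') a a' c c' (b, d) (b', d')
  rw [hc] at this
  exact this.symm

end Reduction

end QMaj

/-! ### The minimal trace as a sublinear function, and its monotonicity under superchannels. -/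

open scoped MatrixOrder Matrix.Norms.L2Operator in
theorem Matrix.IsHermitian.exists_smul_one_sub_posSemidef {n : Type*} [Fintype n] [DecidableEq n]
    {H : Matrix n n ℂ} (hH : H.IsHermitian) :
    ∃ c : ℝ, 0 ≤ c ∧ ((c : ℂ) • (1 : Matrix n n ℂ) - H).PosSemidef := by
  refine ⟨‖H‖, norm_nonneg _, ?_⟩
  have h := IsSelfAdjoint.le_algebraMap_norm_self (a := H) hH
  rw [Matrix.le_iff] at h
  have e : (‖H‖ : ℂ) • (1 : Matrix n n ℂ) = algebraMap ℝ (Matrix n n ℂ) ‖H‖ := by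
    rw [Algebra.algebraMap_eq_smul_one]
    ext i j
    simp [Matrix.one_apply]
  rw [e]
  exact h

theorem Finset.sum_comm_pairs {M α β γ δ : Type*} [AddCommMonoid M] {s : Finset α} {t : Finset β}
    {u : Finset γ} {v : Finset δ} (f : α → β → γ → δ → M) :
    ∑ a ∈ s, ∑ b ∈ t, ∑ c ∈ u, ∑ d ∈ v, f a b c d =
      ∑ c ∈ u, ∑ d ∈ v, ∑ a ∈ s, ∑ b ∈ t, f a b c d := by
  rw [Finset.sum_congr rfl fun a _ => Finset.sum_comm, Finset.sum_comm]
  refine Finset.sum_congr rfl fun c _ => ?_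
  rw [Finset.sum_congr rfl fun a _ => Finset.sum_comm, Finset.sum_comm]

namespace QMaj

section MinTrace

variable {A₀ A₁ B₀ B₁ X Y : Type*} [Fintype A₀] [DecidableEq A₀] [Fintype A₁] [DecidableEq A₁]
  [Fintype B₀] [DecidableEq B₀] [Fintype B₁] [DecidableEq B₁]

variable (B₁) in
/-- `γ ↦ γ ⊗ I^{B₁}`. -/
def ampliate : Op ((A₀ × B₀) × A₁) →ₗ[ℂ] Op ((A₀ × B₀) × (A₁ × B₁)) where
  toFun γ := (γ ⊗ₖ (1 : Op B₁)).submatrix (Equiv.prodAssoc (A₀ × B₀) A₁ B₁).symm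
      (Equiv.prodAssoc (A₀ × B₀) A₁ B₁).symm
  map_add' _ _ := by ext; simp [add_mul]
  map_smul' _ _ := by ext; simp [mul_assoc]

theorem ampliate_apply (γ : Op ((A₀ × B₀) × A₁)) (p q : (A₀ × B₀) × (A₁ × B₁)) :
    ampliate B₁ γ p q = γ (p.1, p.2.1) (q.1, q.2.1) * (1 : Op B₁) p.2.2 q.2.2 := rfl

/-- The constraint `γ^{A₀B₀} = u^{A₀} ⊗ γ^{B₀}`. -/
def IsBalanced (γ : Op ((A₀ × B₀) × A₁)) : Prop :=
  traceSnd γ = uniformState A₀ ⊗ₖ traceFst (traceSnd γ)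

/-- Feasibility with an arbitrary operator in place of the normalized Choi matrix. -/
def Dominates (γ : Op ((A₀ × B₀) × A₁)) (W : Op ((A₀ × B₀) × (A₁ × B₁))) : Prop :=
  γ.IsHermitian ∧ (ampliate B₁ γ - W).PosSemidef ∧ IsBalanced γ

/-- The minimal trace of a balanced operator dominating `W`. -/
def minTraceOf (W : Op ((A₀ × B₀) × (A₁ × B₁))) : ℝ :=
  sInf {t : ℝ | ∃ γ : Op ((A₀ × B₀) × A₁), Dominates γ W ∧ t = γ.trace.re}

theorem minTrace_eq (Ω : LMap (A₀ × B₀) (A₁ × B₁)) : minTrace Ω = minTraceOf (normChoi Ω) := rfl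

theorem trace_traceSnd {n m : Type*} [Fintype n] [Fintype m] (Z : Op (n × m)) :
    (traceSnd Z).trace = Z.trace := by
  simp only [Matrix.trace, Matrix.diag, traceSnd, Matrix.of_apply, Fintype.sum_prod_type]

theorem traceFst_apply {R A : Type*} [Fintype R] (Z : Op (R × A)) (a b : A) :
    traceFst Z a b = ∑ k, Z (k, a) (k, b) := by
  simp [traceFst, Matrix.sum_apply, outBlock_apply]

theorem traceFst_uniform_kronecker [Nonempty A₀] (τ : Op B₀) :
    traceFst (uniformState A₀ ⊗ₖ τ) = τ := by
  ext a b
  simp [traceFst_apply, uniformState]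

/-- Since $u$ has trace one, any $\tau$ in such a factorization must be the $B_0$ marginal. -/
theorem isBalanced_of_eq [Nonempty A₀] {γ : Op ((A₀ × B₀) × A₁)} {τ : Op B₀}
    (h : traceSnd γ = uniformState A₀ ⊗ₖ τ) : IsBalanced γ ∧ γ.trace = τ.trace := by
  have h' : traceFst (traceSnd γ) = τ := by rw [h, traceFst_uniform_kronecker]
  refine ⟨by rw [IsBalanced, h', h], ?_⟩
  rw [← trace_traceSnd, h, Matrix.trace_kronecker]
  simp [uniformState, Matrix.trace_smul]

theorem IsBalanced.trace_eq [Nonempty A₀] {γ : Op ((A₀ × B₀) × A₁)} (h : IsBalanced γ) :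
    γ.trace = (traceFst (traceSnd γ)).trace := (isBalanced_of_eq h).2

theorem IsBalanced.add {γ γ' : Op ((A₀ × B₀) × A₁)} (h : IsBalanced γ) (h' : IsBalanced γ') :
    IsBalanced (γ + γ') := by
  rw [IsBalanced, traceSnd_add, map_add, Matrix.kronecker_add, ← h, ← h']

theorem IsBalanced.smul {γ : Op ((A₀ × B₀) × A₁)} (h : IsBalanced γ) (c : ℂ) :
    IsBalanced (c • γ) := by
  rw [IsBalanced, traceSnd_smul, map_smul, Matrix.kronecker_smul, ← h]

theorem isBalanced_one [Nonempty A₀] : IsBalanced (1 : Op ((A₀ × B₀) × A₁)) := by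
  refine (isBalanced_of_eq (τ := ((Fintype.card A₀ : ℂ) * Fintype.card A₁) • 1) ?_).1
  ext ⟨a, b⟩ ⟨a', b'⟩
  simp only [traceSnd, Matrix.of_apply, uniformState, Matrix.kronecker_apply, Matrix.smul_apply,
    Matrix.one_apply, Prod.mk.injEq, smul_eq_mul]
  split_ifs <;> simp_all

theorem trace_ampliate (γ : Op ((A₀ × B₀) × A₁)) :
    (ampliate B₁ γ).trace = Fintype.card B₁ * γ.trace := by
  simp [Matrix.trace, ampliate_apply, Fintype.sum_prod_type, Finset.mul_sum]

theorem ampliate_one : ampliate B₁ (1 : Op ((A₀ × B₀) × A₁)) = 1 := by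
  ext ⟨p, a, b⟩ ⟨q, a', b'⟩
  simp only [ampliate_apply, Matrix.one_apply, Prod.mk.injEq]
  split_ifs <;> simp_all

theorem Dominates.add {γ γ' : Op ((A₀ × B₀) × A₁)} {W W' : Op ((A₀ × B₀) × (A₁ × B₁))}
    (h : Dominates γ W) (h' : Dominates γ' W') : Dominates (γ + γ') (W + W') := by
  refine ⟨h.1.add h'.1, ?_, h.2.2.add h'.2.2⟩
  rw [map_add, add_sub_add_comm]
  exact h.2.1.add h'.2.1

theorem Dominates.smul {γ : Op ((A₀ × B₀) × A₁)} {W : Op ((A₀ × B₀) × (A₁ × B₁))}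
    (h : Dominates γ W) {c : ℝ} (hc : 0 ≤ c) : Dominates ((c : ℂ) • γ) ((c : ℂ) • W) := by
  have hc' : (0 : ℂ) ≤ (c : ℂ) := by exact_mod_cast hc
  refine ⟨IsSelfAdjoint.smul (.of_nonneg hc') h.1, ?_, h.2.2.smul _⟩
  rw [map_smul, ← smul_sub]
  exact h.2.1.smul hc'

/-- Bounds the feasible traces from below, so that the real `sInf` is a true infimum;
`exists_dominates` supplies nonemptiness. -/
theorem Dominates.trace_le {γ : Op ((A₀ × B₀) × A₁)} {W : Op ((A₀ × B₀) × (A₁ × B₁))}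
    (h : Dominates γ W) : W.trace.re ≤ Fintype.card B₁ * γ.trace.re := by
  have h1 := h.2.1.trace_nonneg
  rw [Matrix.trace_sub, trace_ampliate] at h1
  have := (Complex.le_def.1 h1).1
  simp at this
  linarith

theorem exists_dominates [Nonempty A₀] {W : Op ((A₀ × B₀) × (A₁ × B₁))} (hW : W.IsHermitian) :
    ∃ γ : Op ((A₀ × B₀) × A₁), Dominates γ W := by
  obtain ⟨c, hc, h⟩ := hW.exists_smul_one_sub_posSemidef
  refine ⟨(c : ℂ) • 1, ?_, ?_, isBalanced_one.smul _⟩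
  · exact IsSelfAdjoint.smul (.of_nonneg (by exact_mod_cast hc)) Matrix.isHermitian_one
  · rwa [map_smul, ampliate_one]

theorem le_minTraceOf [Nonempty A₀] {W : Op ((A₀ × B₀) × (A₁ × B₁))} (hW : W.IsHermitian) {t : ℝ}
    (h : ∀ γ : Op ((A₀ × B₀) × A₁), Dominates γ W → t ≤ γ.trace.re) : t ≤ minTraceOf W := by
  obtain ⟨γ, hγ⟩ := exists_dominates hW
  refine le_csInf ⟨_, γ, hγ, rfl⟩ ?_
  rintro _ ⟨γ, hγ, rfl⟩
  exact h γ hγ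

theorem Dominates.minTraceOf_le [Nonempty B₁] {γ : Op ((A₀ × B₀) × A₁)}
    {W : Op ((A₀ × B₀) × (A₁ × B₁))} (h : Dominates γ W) : minTraceOf W ≤ γ.trace.re := by
  refine csInf_le ⟨W.trace.re / Fintype.card B₁, ?_⟩ ⟨γ, h, rfl⟩
  rintro _ ⟨γ, hγ, rfl⟩
  rw [div_le_iff₀' (by exact_mod_cast Fintype.card_pos)]
  exact hγ.trace_le

theorem minTraceOf_nonneg [Nonempty A₀] [Nonempty B₁] {W : Op ((A₀ × B₀) × (A₁ × B₁))}
    (hW : W.PosSemidef) : 0 ≤ minTraceOf W := by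
  refine le_minTraceOf hW.1 fun γ hγ => ?_
  have h1 := (Complex.le_def.1 hW.trace_nonneg).1.trans hγ.trace_le
  exact nonneg_of_mul_nonneg_right h1 (by exact_mod_cast Fintype.card_pos)

theorem minTraceOf_add_le [Nonempty A₀] [Nonempty B₁] {W W' : Op ((A₀ × B₀) × (A₁ × B₁))}
    (hW : W.IsHermitian) (hW' : W'.IsHermitian) :
    minTraceOf (W + W') ≤ minTraceOf W + minTraceOf W' := by
  rw [← sub_le_iff_le_add]
  refine le_minTraceOf hW fun γ hγ => ?_
  rw [sub_le_comm]
  refine le_minTraceOf hW' fun γ' hγ' => ?_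
  rw [sub_le_iff_le_add']
  simpa using (hγ.add hγ').minTraceOf_le

theorem minTraceOf_smul_le [Nonempty A₀] [Nonempty B₁] {W : Op ((A₀ × B₀) × (A₁ × B₁))}
    (hW : W.IsHermitian) {c : ℝ} (hc : 0 < c) :
    minTraceOf ((c : ℂ) • W) ≤ c * minTraceOf W := by
  rw [← div_le_iff₀' hc]
  refine le_minTraceOf hW fun γ hγ => ?_
  rw [div_le_iff₀' hc]
  simpa using (hγ.smul hc.le).minTraceOf_le

theorem minTraceOf_smul [Nonempty A₀] [Nonempty B₁] {W : Op ((A₀ × B₀) × (A₁ × B₁))}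
    (hW : W.IsHermitian) {c : ℝ} (hc : 0 < c) :
    minTraceOf ((c : ℂ) • W) = c * minTraceOf W := by
  refine le_antisymm (minTraceOf_smul_le hW hc) ?_
  have hcW : ((c : ℂ) • W).IsHermitian :=
    IsSelfAdjoint.smul (.of_nonneg (by exact_mod_cast hc.le)) hW
  have := minTraceOf_smul_le hcW (inv_pos.2 hc)
  rw [smul_smul, ← Complex.ofReal_mul, inv_mul_cancel₀ hc.ne', Complex.ofReal_one, one_smul,
    ← div_eq_inv_mul, le_div_iff₀' hc] at this
  exact this

theorem choi_pairing [Fintype X] [Fintype Y] (F : X → Y → LMap A₀ A₁) (Λ : X → Y → LMap B₀ B₁)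
    (p q : (A₀ × B₀) × (A₁ × B₁)) :
    choi (pairing F Λ) p q = (Fintype.card X : ℂ)⁻¹ * ∑ x, ∑ y,
      choi (F x y) (p.1.1, p.2.1) (q.1.1, q.2.1) * choi (Λ x y) (p.1.2, p.2.2) (q.1.2, q.2.2) := by
  simp only [pairing, choi_smul, choi_sum, choi_tensorMap, Matrix.smul_apply, Matrix.sum_apply,
    smul_eq_mul]
  rfl

theorem normChoi_pairing_posSemidef [Fintype X] [Fintype Y] {F : X → Y → LMap A₀ A₁}
    {Λ : X → Y → LMap B₀ B₁} (hF : ∀ x y, (choi (F x y)).PosSemidef)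
    (hΛ : ∀ x y, (choi (Λ x y)).PosSemidef) : (normChoi (pairing F Λ)).PosSemidef := by
  have hc : ∀ n : ℕ, (0 : ℂ) ≤ (n : ℂ)⁻¹ := fun n => by
    rw [← Complex.ofReal_natCast, ← Complex.ofReal_inv]
    exact_mod_cast (by positivity : (0 : ℝ) ≤ (n : ℝ)⁻¹)
  rw [normChoi, mul_inv]
  refine Matrix.PosSemidef.smul ?_ (mul_nonneg (hc _) (hc _))
  simp only [pairing, choi_smul, choi_sum, choi_tensorMap]
  exact (Matrix.posSemidef_sum _ fun x _ => Matrix.posSemidef_sum _ fun y _ =>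
    ((hF x y).kronecker (hΛ x y)).submatrix _).smul (hc _)

variable {A₀' A₁' : Type*} [Fintype A₀'] [DecidableEq A₀'] [Fintype A₁'] [DecidableEq A₁']

/-- The image of a balanced operator under a superchannel acting on the first party. -/
def pushforward (Θ : SuperMap A₀ A₁ A₀' A₁') (γ : Op ((A₀ × B₀) × A₁)) :
    Op ((A₀' × B₀) × A₁') :=
  ((Fintype.card A₀ : ℂ) / Fintype.card A₀') • Matrix.of fun p q =>
    ∑ i : A₀ × A₁, ∑ j : A₀ × A₁, γ ((i.1, p.1.2), i.2) ((j.1, q.1.2), j.2) *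
      superChoi Θ (i, (p.1.1, p.2)) (j, (q.1.1, q.2))

/-- For fixed indices $b,b'$ of $B_0$, balance says that the corresponding block of $\gamma$ is the
Choi matrix of a map that is TP up to a scalar, which $\Theta$ preserves. -/
theorem traceSnd_pushforward [Nonempty A₀] [Nonempty A₁] {Θ : SuperMap A₀ A₁ A₀' A₁'}
    (hΘ : IsTPP Θ) {γ : Op ((A₀ × B₀) × A₁)} (hγ : IsBalanced γ) :
    traceSnd (pushforward Θ γ) = uniformState A₀' ⊗ₖ traceFst (traceSnd γ) := by
  ext ⟨a, b⟩ ⟨a', b'⟩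
  let Ω : LMap A₀ A₁ := ofChoi (Matrix.of fun i j => γ ((i.1, b), i.2) ((j.1, b'), j.2))
  have hΩ : traceSnd (choi Ω) =
      ((Fintype.card A₀ : ℂ)⁻¹ * traceFst (traceSnd γ) b b') • 1 := by
    ext i j
    have h1 := congrFun (congrFun hγ (i, b)) (j, b')
    rw [choi_ofChoi]
    refine h1.trans ?_
    simp only [uniformState, Matrix.kronecker_apply, Matrix.smul_apply, smul_eq_mul]
    ring
  have h2 := congrFun (congrFun (hΘ.traceSnd_choi hΩ) a) a'
  have h3 : traceSnd (pushforward Θ γ) (a, b) (a', b') =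
      ((Fintype.card A₀ : ℂ) / Fintype.card A₀') * traceSnd (choi (Θ Ω)) a a' := by
    simp only [traceSnd, Matrix.of_apply, pushforward, choi_supermap_apply, Ω, choi_ofChoi,
      Matrix.smul_apply, smul_eq_mul, Finset.mul_sum]
  rw [h3, h2]
  have : (Fintype.card A₀ : ℂ) ≠ 0 := by exact_mod_cast Fintype.card_ne_zero
  simp only [uniformState, Matrix.kronecker_apply, Matrix.smul_apply, smul_eq_mul]
  field_simp

/-- Contracting the positive gap $\gamma\otimes I-\omega$ with the Choi matrix of $\Theta$ gives the
new gap. The prefactor $d_{A_0}/d_{A_0'}$ in `pushforward` converts between the two Choi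
normalizations and keeps the trace unchanged. -/
theorem Dominates.pushforward [Nonempty A₀] [Nonempty A₁] [Nonempty A₀'] [Fintype X] [Fintype Y]
    {Θ : SuperMap A₀ A₁ A₀' A₁'} (hΘ : IsSuperchannel Θ) {F : X → Y → LMap A₀ A₁}
    {Λ : X → Y → LMap B₀ B₁} {γ : Op ((A₀ × B₀) × A₁)} (h : Dominates γ (normChoi (pairing F Λ))) :
    Dominates (pushforward Θ γ) (normChoi (pairing (fun x y => Θ (F x y)) Λ)) ∧
      (QMaj.pushforward Θ γ).trace = γ.trace := by
  have hJ := superChoi_posSemidef hΘ.1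
  obtain ⟨h1, h2⟩ := isBalanced_of_eq (traceSnd_pushforward hΘ.2 h.2.2)
  refine ⟨⟨?_, ?_, h1⟩, h2.trans h.2.2.trace_eq.symm⟩
  · ext p q
    simp only [QMaj.pushforward, Matrix.conjTranspose_apply, Matrix.smul_apply, Matrix.of_apply,
      smul_eq_mul, star_mul', star_sum, star_div₀, star_natCast, h.1.apply, hJ.1.apply]
    rw [Finset.sum_comm]
  · have hc : (0 : ℂ) ≤ (Fintype.card A₀ : ℂ) / Fintype.card A₀' := by
      rw [← Complex.ofReal_natCast, ← Complex.ofReal_natCast, ← Complex.ofReal_div]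
      exact_mod_cast (by positivity : (0 : ℝ) ≤ (Fintype.card A₀ : ℝ) / Fintype.card A₀')
    convert ((h.2.1.kronecker hJ).contract
      (fun (a : (A₀' × B₀) × (A₁' × B₁)) (i : A₀ × A₁) =>
        (((i.1, a.1.2), (i.2, a.2.2)), (i, (a.1.1, a.2.1))))).smul hc using 1
    have hA : (Fintype.card A₀ : ℂ) ≠ 0 := by exact_mod_cast Fintype.card_ne_zero
    ext p q
    simp only [Matrix.sub_apply, ampliate_apply, QMaj.pushforward, Matrix.smul_apply,
      Matrix.of_apply, smul_eq_mul, normChoi, choi_pairing, Matrix.kronecker_apply, sub_mul,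
      Finset.sum_sub_distrib, mul_sub, choi_supermap_apply]
    congr 1
    · rw [mul_assoc, Finset.sum_mul]
      simp only [Finset.sum_mul]
      exact congrArg _ (Finset.sum_congr rfl fun x _ => Finset.sum_congr rfl fun i _ =>
        mul_right_comm _ _ _)
    · have e : ((Fintype.card A₀' : ℂ) * Fintype.card B₀)⁻¹ =
          (Fintype.card A₀ : ℂ) / Fintype.card A₀' *
            ((Fintype.card A₀ : ℂ) * Fintype.card B₀)⁻¹ := by
        field_simp
      rw [e, mul_assoc]
      congr 1
      simp only [mul_assoc, ← Finset.mul_sum]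
      congr 2
      simp only [Finset.sum_mul]
      rw [Finset.sum_comm_pairs]
      congr! 4
      ring

theorem minTrace_supermap_le [Nonempty A₀] [Nonempty A₁] [Nonempty A₀'] [Nonempty B₁]
    [Fintype X] [Fintype Y] {Θ : SuperMap A₀ A₁ A₀' A₁'} (hΘ : IsSuperchannel Θ)
    {F : X → Y → LMap A₀ A₁} {Λ : X → Y → LMap B₀ B₁} (hF : ∀ x y, (choi (F x y)).PosSemidef)
    (hΛ : ∀ x y, (choi (Λ x y)).PosSemidef) :
    minTrace (pairing (fun x y => Θ (F x y)) Λ) ≤ minTrace (pairing F Λ) := by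
  refine le_minTraceOf (normChoi_pairing_posSemidef hF hΛ).1 fun γ hγ => ?_
  obtain ⟨h1, h2⟩ := hγ.pushforward hΘ
  rw [← h2]
  exact h1.minTraceOf_le

theorem Hminext_le_iff {A₀' A₁' : Type*} [Fintype A₀'] [DecidableEq A₀'] [Fintype A₁']
    {Ω : LMap (A₀ × B₀) (A₁ × B₁)} {Ω' : LMap (A₀' × B₀) (A₁' × B₁)}
    (h : 0 ≤ minTrace Ω) (h' : 0 ≤ minTrace Ω') :
    Hminext Ω ≤ Hminext Ω' ↔ minTrace Ω' ≤ minTrace Ω := by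
  unfold Hminext
  split_ifs with h0 h1 h1
  · simp [h0, h1]
  · simp only [top_le_iff, EReal.coe_ne_top, false_iff, not_le, h0]
    exact lt_of_le_of_ne h' (Ne.symm h1)
  · simp [h, h1]
  · rw [EReal.coe_le_coe_iff, neg_le_neg_iff, Real.logb_le_logb (by norm_num)
      (lt_of_le_of_ne h' (Ne.symm h1)) (lt_of_le_of_ne h (Ne.symm h0))]

end MinTrace

end QMaj

/-! ### A form of the Hahn–Banach theorem. -/

/-- Hahn–Banach for a functional given along a linear map. -/
theorem LinearMap.exists_comp_eq_of_le_sublinear {V E : Type*} [AddCommGroup V] [Module ℝ V]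
    [AddCommGroup E] [Module ℝ E] (M : V →ₗ[ℝ] E) (ψ : V →ₗ[ℝ] ℝ) (N : E → ℝ)
    (N_hom : ∀ c : ℝ, 0 < c → ∀ x, N (c • x) = c * N x) (N_add : ∀ x y, N (x + y) ≤ N x + N y)
    (h : ∀ v, ψ v ≤ N (M v)) :
    ∃ g : E →ₗ[ℝ] ℝ, (∀ v, g (M v) = ψ v) ∧ ∀ x, g x ≤ N x := by
  have N_0 : N 0 = 0 := by
    have := N_hom 2 (by norm_num) 0
    rw [smul_zero] at this
    linarith
  -- The bound at $v$ and at $-v$, with $N(0)=0$, forces $\psi(v)=0$ on the kernel, so $\psi$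
  -- descends to the range of $M$.
  have hker : M.ker ≤ ψ.ker := by
    intro v hv
    rw [LinearMap.mem_ker] at hv ⊢
    have h1 := h v
    have h2 := h (-v)
    simp only [map_neg, hv, neg_zero, N_0] at h1 h2
    linarith
  let f : M.range →ₗ[ℝ] ℝ := (M.ker.liftQ ψ hker) ∘ₗ M.quotKerEquivRange.symm.toLinearMap
  have hf : ∀ v, f ⟨M v, v, rfl⟩ = ψ v := by
    intro v
    have : M.quotKerEquivRange.symm ⟨M v, v, rfl⟩ = M.ker.mkQ v :=
      M.quotKerEquivRange_symm_apply_image v ⟨v, rfl⟩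
    simp [f, this]
  obtain ⟨g, hg, hN⟩ := exists_extension_of_le_sublinear ⟨M.range, f⟩ N N_hom N_add (by
    rintro ⟨_, v, rfl⟩
    exact (hf v).le.trans (h v))
  exact ⟨g, fun v => (hg ⟨M v, v, rfl⟩).trans (hf v), hN⟩

namespace QMaj

/-! ### Membership in $\mathcal C_\star$ in terms of Choi matrices. -/

section Classical

variable {B₀ B₁ X Y : Type*} [Fintype B₀] [DecidableEq B₀] [Fintype B₁] [DecidableEq B₁]
  [Fintype X] [DecidableEq X] [Fintype Y] [DecidableEq Y]

theorem choi_cqMap (Λ : X → Y → LMap B₀ B₁) (p q : B₀ × ((X × Y) × B₁)) :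
    choi (cqMap Λ) p q = (Fintype.card X : ℂ)⁻¹ *
      if p.2.1 = q.2.1 then choi (Λ p.2.1.1 p.2.1.2) (p.1, p.2.2) (q.1, q.2.2) else 0 := by
  obtain ⟨b, ⟨x, y⟩, k⟩ := p
  obtain ⟨b', ⟨x', y'⟩, k'⟩ := q
  simp only [cqMap, choi_smul, choi_sum, Matrix.smul_apply, smul_eq_mul, Matrix.sum_apply]
  congr 1
  simp only [choi, Matrix.of_apply, LinearMap.comp_apply, inBlock, kronLeft_apply]
  rw [← Fintype.sum_prod_type' (f := fun i j => Matrix.single (i, j) (i, j) (1 : ℂ) (x, y) (x', y') *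
      (Λ i j) (Matrix.single b b' 1) k k'), Finset.sum_eq_single (x, y)
      (by intro z _ hz; simp [hz]) (by simp)]
  simp [Matrix.single_apply]

theorem InCStar.choi_posSemidef [Nonempty X] {Λ : X → Y → LMap B₀ B₁} (h : InCStar Λ) (x : X)
    (y : Y) : (choi (Λ x y)).PosSemidef := by
  have h1 := ((isCP_iff _).1 h.1.1).submatrix (fun p : B₀ × B₁ => (p.1, ((x, y), p.2)))
  have hX : (0 : ℝ) ≤ Fintype.card X := by positivity
  have h2 := h1.smul (a := ((Fintype.card X : ℝ) : ℂ)) (by exact_mod_cast hX)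
  convert h2 using 1
  ext p q
  simp [choi_cqMap]

theorem inCStar_of_choi [Nonempty X] {Λ : X → Y → LMap B₀ B₁}
    (h : ∀ x y, (choi (Λ x y)).PosSemidef) (h' : ∀ x, traceSnd (∑ y, choi (Λ x y)) = 1) :
    InCStar Λ := by
  have hX : (Fintype.card X : ℂ) ≠ 0 := by exact_mod_cast Fintype.card_ne_zero
  refine ⟨⟨(isCP_iff _).2 ?_, (isTP_iff _).2 ?_⟩, fun x => ⟨(isCP_iff _).2 ?_, (isTP_iff _).2 ?_⟩⟩
  · have hc : (0 : ℂ) ≤ (Fintype.card X : ℂ)⁻¹ := by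
      rw [← Complex.ofReal_natCast, ← Complex.ofReal_inv]
      exact_mod_cast (by positivity : (0 : ℝ) ≤ (Fintype.card X : ℝ)⁻¹)
    have hs : ∀ z : X × Y, (Matrix.single z z (1 : ℂ)).PosSemidef := by
      intro z
      rw [← Matrix.diagonal_single]
      exact Matrix.PosSemidef.diagonal (Pi.single_nonneg.2 zero_le_one)
    have e : choi (cqMap Λ) = (Fintype.card X : ℂ)⁻¹ • ∑ z : X × Y,
        (Matrix.single z z (1 : ℂ) ⊗ₖ choi (Λ z.1 z.2)).submatrix
          (fun p : B₀ × ((X × Y) × B₁) => (p.2.1, (p.1, p.2.2)))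
          (fun p : B₀ × ((X × Y) × B₁) => (p.2.1, (p.1, p.2.2))) := by
      ext p q
      rw [choi_cqMap, Matrix.smul_apply, Matrix.sum_apply, Finset.sum_eq_single p.2.1
        (by intro z _ hz; simp [hz]) (by simp)]
      simp [Matrix.single_apply]
    rw [e]
    exact (Matrix.posSemidef_sum _ fun z _ => ((hs z).kronecker (h z.1 z.2)).submatrix _).smul hc
  · ext i j
    have h2 : ∀ x, ∑ y, ∑ k, choi (Λ x y) (i, k) (j, k) = (1 : Op B₀) i j := by
      intro x
      rw [← h' x]
      simp only [traceSnd, Matrix.of_apply, Matrix.sum_apply]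
      rw [Finset.sum_comm]
    simp only [traceSnd, Matrix.of_apply, choi_cqMap, if_true, Fintype.sum_prod_type,
      ← Finset.mul_sum, h2]
    simp [hX]
  · rw [choi_sum]
    exact Matrix.posSemidef_sum _ fun y _ => h x y
  · rw [choi_sum, h']

end Classical

/-! ### Weak duality and the inequality for normalized positive families. -/

section Duality

variable {A₀ A₁ B₀ B₁ X Y : Type*} [Fintype A₀] [DecidableEq A₀] [Fintype A₁] [DecidableEq A₁]
  [Fintype B₀] [DecidableEq B₀] [Fintype B₁] [DecidableEq B₁] [Fintype X] [Fintype Y]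

/-- The bilinear pairing `Tr[W Cᵀ]`. -/
def choiPair {n : Type*} [Fintype n] (W C : Op n) : ℂ := ∑ p, ∑ q, W p q * C p q

/-- The Choi matrix of `∑ x y, F x y ⊗ W x y`, with `W x y` given by Choi matrices. -/
def jointChoi (F : X → Y → LMap A₀ A₁) (W : X → Y → Op (B₀ × B₁)) :
    Op ((A₀ × B₀) × (A₁ × B₁)) :=
  ∑ x, ∑ y, (choi (F x y) ⊗ₖ W x y).submatrix
    (Equiv.prodProdProdComm A₀ B₀ A₁ B₁) (Equiv.prodProdProdComm A₀ B₀ A₁ B₁)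

theorem jointChoi_apply (F : X → Y → LMap A₀ A₁) (W : X → Y → Op (B₀ × B₁))
    (p q : (A₀ × B₀) × (A₁ × B₁)) :
    jointChoi F W p q = ∑ x, ∑ y, choi (F x y) (p.1.1, p.2.1) (q.1.1, q.2.1) *
      W x y (p.1.2, p.2.2) (q.1.2, q.2.2) := by
  simp only [jointChoi, Matrix.sum_apply]
  rfl

theorem jointChoi_add (F : X → Y → LMap A₀ A₁) (W W' : X → Y → Op (B₀ × B₁)) :
    jointChoi F (W + W') = jointChoi F W + jointChoi F W' := by
  ext p q
  simp [jointChoi_apply, mul_add, Finset.sum_add_distrib]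

theorem jointChoi_smul (F : X → Y → LMap A₀ A₁) (c : ℂ) (W : X → Y → Op (B₀ × B₁)) :
    jointChoi F (c • W) = c • jointChoi F W := by
  ext p q
  simp [jointChoi_apply, Finset.mul_sum, mul_left_comm]

theorem jointChoi_isHermitian {F : X → Y → LMap A₀ A₁} {W : X → Y → Op (B₀ × B₁)}
    (hF : ∀ x y, (choi (F x y)).PosSemidef) (hW : ∀ x y, (W x y).IsHermitian) :
    (jointChoi F W).IsHermitian := by
  ext p q
  simp only [Matrix.conjTranspose_apply, jointChoi_apply, star_sum, star_mul', (hF _ _).1.apply,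
    (hW _ _).apply]

theorem normChoi_pairing (F : X → Y → LMap A₀ A₁) (Λ : X → Y → LMap B₀ B₁) :
    normChoi (pairing F Λ) =
      (((Fintype.card A₀ * Fintype.card B₀ * Fintype.card X : ℝ)⁻¹ : ℝ) : ℂ) •
        jointChoi F (fun x y => choi (Λ x y)) := by
  ext p q
  simp only [normChoi, Matrix.smul_apply, choi_pairing, jointChoi_apply, smul_eq_mul]
  push_cast
  rw [mul_inv _ (Fintype.card X : ℂ), mul_assoc]

/-- Weak duality with the identity superchannel. -/
theorem Dominates.le_trace_of_self [Nonempty B₀] {γ : Op ((B₀ × B₀) × B₁)}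
    {W : Op ((B₀ × B₀) × (B₁ × B₁))} (h : Dominates γ W) :
    Fintype.card B₀ * (∑ p : B₀ × B₁, ∑ q : B₀ × B₁,
      W ((p.1, p.1), (p.2, p.2)) ((q.1, q.1), (q.2, q.2))).re ≤ γ.trace.re := by
  -- This is the expectation of the gap in the unnormalized maximally entangled vector between the
  -- two copies of $B$, viewed as a one-by-one matrix.
  have h1 := (h.2.1.contract (fun (_ : Unit) (i : B₀ × B₁) =>
    ((i.1, i.1), (i.2, i.2)))).diag_nonneg (i := ())
  have hB : (Fintype.card B₀ : ℂ) ≠ 0 := by exact_mod_cast Fintype.card_ne_zero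
  have h2 : ∑ p : B₀ × B₁, ∑ q : B₀ × B₁,
      ampliate B₁ γ ((p.1, p.1), (p.2, p.2)) ((q.1, q.1), (q.2, q.2)) =
        (Fintype.card B₀ : ℂ)⁻¹ * γ.trace := by
    -- Balance enters here: the marginal $u\otimes\tau$ has expectation ${\rm Tr}\,\tau/d_{B_0}$.
    have h3 : ∑ b, ∑ b', traceSnd γ (b, b) (b', b') = (Fintype.card B₀ : ℂ)⁻¹ * γ.trace := by
      rw [h.2.2.trace_eq]
      conv_lhs => rw [h.2.2]
      simp [uniformState, Matrix.one_apply, Matrix.trace, Finset.mul_sum]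
    rw [← h3]
    simp only [ampliate_apply, Fintype.sum_prod_type, traceSnd, Matrix.of_apply, Matrix.one_apply]
    refine Finset.sum_congr rfl fun b _ => ?_
    rw [Finset.sum_comm]
    refine Finset.sum_congr rfl fun b' _ => ?_
    simp
  simp only [Matrix.of_apply, Matrix.sub_apply, Finset.sum_sub_distrib] at h1
  rw [h2] at h1
  have h4 := (Complex.le_def.1 h1).1
  have hB' : (0 : ℝ) < Fintype.card B₀ := by exact_mod_cast Fintype.card_pos
  have h5 : ((Fintype.card B₀ : ℂ)⁻¹ * γ.trace).re = (Fintype.card B₀ : ℝ)⁻¹ * γ.trace.re := by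
    rw [← Complex.ofReal_natCast, ← Complex.ofReal_inv, Complex.re_ofReal_mul]
  rw [Complex.sub_re, h5, Complex.zero_re, sub_nonneg, le_inv_mul_iff₀ hB'] at h4
  exact h4

/-- Weak duality bounds the minimum for $G$ below; the hypothesis transfers the bound to $F$, and
homogeneity removes the normalizations, leaving the factor $d_{A_0}$. -/
theorem choiPair_le_minTraceOf [Nonempty A₀] [Nonempty B₀] [Nonempty B₁] [Nonempty X]
    {F : X → Y → LMap A₀ A₁} {G Λ : X → Y → LMap B₀ B₁} (hF : ∀ x y, (choi (F x y)).PosSemidef)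
    (hG : ∀ x y, (choi (G x y)).PosSemidef) (hΛ : ∀ x y, (choi (Λ x y)).PosSemidef)
    (h : minTrace (pairing G Λ) ≤ minTrace (pairing F Λ)) :
    Fintype.card A₀ * (∑ x, ∑ y, choiPair (choi (Λ x y)) (choi (G x y))).re ≤
      minTraceOf (jointChoi F (fun x y => choi (Λ x y))) := by
  have hA : (0 : ℝ) < Fintype.card A₀ := by exact_mod_cast Fintype.card_pos
  have hB : (0 : ℝ) < Fintype.card B₀ := by exact_mod_cast Fintype.card_pos
  have hX : (0 : ℝ) < Fintype.card X := by exact_mod_cast Fintype.card_pos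
  have h1 : (Fintype.card B₀ * Fintype.card X : ℝ)⁻¹ *
      (∑ x, ∑ y, choiPair (choi (Λ x y)) (choi (G x y))).re ≤ minTrace (pairing G Λ) := by
    refine le_minTraceOf (normChoi_pairing_posSemidef hG hΛ).1 fun γ hγ => ?_
    refine le_of_eq_of_le ?_ hγ.le_trace_of_self
    have e : ∑ p : B₀ × B₁, ∑ q : B₀ × B₁, normChoi (pairing G Λ)
        ((p.1, p.1), (p.2, p.2)) ((q.1, q.1), (q.2, q.2)) =
          (((Fintype.card B₀ * Fintype.card B₀ * Fintype.card X : ℝ)⁻¹ : ℝ) : ℂ) *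
            ∑ x, ∑ y, choiPair (choi (Λ x y)) (choi (G x y)) := by
      simp only [normChoi_pairing, Matrix.smul_apply, smul_eq_mul, jointChoi_apply,
        ← Finset.mul_sum, choiPair]
      rw [Finset.sum_comm_pairs]
      simp only [mul_comm (choi (Λ _ _) _ _)]
    rw [e, Complex.re_ofReal_mul]
    field_simp
  have h2 := h1.trans h
  rw [minTrace_eq, normChoi_pairing, minTraceOf_smul
    (jointChoi_isHermitian hF fun x y => (hΛ x y).1) (by positivity)] at h2
  rw [inv_mul_le_iff₀ (by positivity), ← mul_assoc] at h2
  have h3 : (Fintype.card B₀ * Fintype.card X : ℝ) *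
      (Fintype.card A₀ * Fintype.card B₀ * Fintype.card X : ℝ)⁻¹ = (Fintype.card A₀ : ℝ)⁻¹ := by
    field_simp
  rwa [h3, le_inv_mul_iff₀ hA] at h2

end Duality

/-! ### From normalized positive families to arbitrary Hermitian ones. -/

section Shift

variable {A₀ A₁ B₀ B₁ X Y : Type*} [Fintype A₀] [DecidableEq A₀] [Fintype A₁] [DecidableEq A₁]
  [Fintype B₀] [DecidableEq B₀] [Fintype B₁] [DecidableEq B₁] [Fintype X] [Fintype Y]

theorem traceSnd_kronecker_one {n m : Type*} [Fintype m] [DecidableEq m] (Z : Op n) :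
    traceSnd (Z ⊗ₖ (1 : Op m)) = (Fintype.card m : ℂ) • Z := by
  ext a b
  simp [traceSnd]

theorem isHermitian_kronecker_one {n m : Type*} [DecidableEq m] {Z : Op n}
    (hZ : Z.IsHermitian) : (Z ⊗ₖ (1 : Op m)).IsHermitian := by
  rw [Matrix.IsHermitian, Matrix.conjTranspose_kronecker, hZ.eq, Matrix.conjTranspose_one]

theorem traceSnd_conjTranspose {n m : Type*} [Fintype m] (Z : Op (n × m)) :
    traceSnd Z.conjTranspose = (traceSnd Z).conjTranspose := by
  ext a b
  simp [traceSnd]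

theorem choiPair_add {n : Type*} [Fintype n] (W W' C : Op n) :
    choiPair (W + W') C = choiPair W C + choiPair W' C := by
  simp [choiPair, add_mul, Finset.sum_add_distrib]

theorem choiPair_smul {n : Type*} [Fintype n] (c : ℂ) (W C : Op n) :
    choiPair (c • W) C = c * choiPair W C := by
  simp [choiPair, mul_assoc, Finset.mul_sum]

theorem choiPair_sum_right {n ι : Type*} [Fintype n] (s : Finset ι) (W : Op n) (C : ι → Op n) :
    ∑ i ∈ s, choiPair W (C i) = choiPair W (∑ i ∈ s, C i) := by
  simp only [choiPair, Matrix.sum_apply, Finset.mul_sum]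
  rw [Finset.sum_comm]
  refine Finset.sum_congr rfl fun p _ => ?_
  rw [Finset.sum_comm]

theorem choiPair_kronecker_one {C : Op (B₀ × B₁)} (hC : traceSnd C = 1) (Z : Op B₀) :
    choiPair (Z ⊗ₖ (1 : Op B₁)) C = Z.trace := by
  have h : ∀ b b', Z b b' * traceSnd C b b' = ∑ k, Z b b' * C (b, k) (b', k) := fun b b' => by
    simp [traceSnd, Finset.mul_sum]
  have : Z.trace = ∑ b, ∑ b', Z b b' * traceSnd C b b' := by
    simp [hC, Matrix.one_apply, Matrix.trace]
  rw [this]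
  simp only [h, choiPair, Fintype.sum_prod_type, Matrix.kronecker_apply, Matrix.one_apply]
  refine Finset.sum_congr rfl fun b _ => ?_
  rw [Finset.sum_comm]
  refine Finset.sum_congr rfl fun b' _ => ?_
  simp

/-- Operators `Z x ⊗ I`, independent of `y`, contribute a balanced ampliation. -/
theorem minTraceOf_jointChoi_kronecker_one_le [Nonempty A₀] [Nonempty B₁]
    {F : X → Y → LMap A₀ A₁} (hF : ∀ x y, (choi (F x y)).PosSemidef)
    (hF' : ∀ x, traceSnd (∑ y, choi (F x y)) = 1) {Z : X → Op B₀} (hZ : ∀ x, (Z x).IsHermitian) :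
    minTraceOf (jointChoi F fun x _ => Z x ⊗ₖ (1 : Op B₁)) ≤
      Fintype.card A₀ * (∑ x, (Z x).trace).re := by
  let γ : Op ((A₀ × B₀) × A₁) := Matrix.of fun p q =>
    ∑ x, (∑ y, choi (F x y)) (p.1.1, p.2) (q.1.1, q.2) * Z x p.1.2 q.1.2
  have hsnd : traceSnd γ = uniformState A₀ ⊗ₖ ((Fintype.card A₀ : ℂ) • ∑ x, Z x) := by
    have hA : (Fintype.card A₀ : ℂ) ≠ 0 := by exact_mod_cast Fintype.card_ne_zero
    ext ⟨a, b⟩ ⟨a', b'⟩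
    have h1 : ∀ x, ∑ k, ∑ y, choi (F x y) (a, k) (a', k) = (1 : Op A₀) a a' := by
      intro x
      rw [← hF' x]
      simp only [traceSnd, Matrix.of_apply, Matrix.sum_apply]
    simp only [traceSnd, γ, Matrix.of_apply, Matrix.sum_apply]
    rw [Finset.sum_comm]
    simp only [← Finset.sum_mul, h1, uniformState, Matrix.kronecker_apply, Matrix.smul_apply,
      Matrix.sum_apply, smul_eq_mul, ← Finset.mul_sum]
    field_simp
  obtain ⟨hb, htr⟩ := isBalanced_of_eq hsnd
  have hamp : (jointChoi F fun x _ => Z x ⊗ₖ (1 : Op B₁)) = ampliate B₁ γ := by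
    ext p q
    simp only [jointChoi_apply, ampliate_apply, γ, Matrix.of_apply, Matrix.sum_apply,
      Matrix.kronecker_apply, Finset.sum_mul, mul_assoc]
  have hd : Dominates γ (jointChoi F fun x _ => Z x ⊗ₖ (1 : Op B₁)) := by
    refine ⟨?_, ?_, hb⟩
    · ext p q
      simp only [γ, Matrix.conjTranspose_apply, Matrix.of_apply, Matrix.sum_apply, star_sum,
        star_mul', (hF _ _).1.apply, (hZ _).apply]
    · rw [hamp, sub_self]
      exact Matrix.PosSemidef.zero
  refine hd.minTraceOf_le.trans_eq ?_
  rw [htr, Matrix.trace_smul, Matrix.trace_sum, smul_eq_mul, ← Complex.ofReal_natCast,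
    Complex.re_ofReal_mul]

/-- An inequality for all normalized positive families extends to all Hermitian families. -/
theorem choiPair_le_of_isHermitian [Nonempty A₀] [Nonempty B₀] [Nonempty B₁] [Nonempty Y]
    {F : X → Y → LMap A₀ A₁} {G : X → Y → LMap B₀ B₁}
    (hF : ∀ x y, (choi (F x y)).PosSemidef) (hF' : ∀ x, traceSnd (∑ y, choi (F x y)) = 1)
    (hG' : ∀ x, traceSnd (∑ y, choi (G x y)) = 1)
    (h : ∀ V : X → Y → Op (B₀ × B₁), (∀ x y, (V x y).PosSemidef) →
      (∀ x, traceSnd (∑ y, V x y) = 1) →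
      Fintype.card A₀ * (∑ x, ∑ y, choiPair (V x y) (choi (G x y))).re ≤
        minTraceOf (jointChoi F V))
    {W : X → Y → Op (B₀ × B₁)} (hW : ∀ x y, (W x y).IsHermitian) :
    Fintype.card A₀ * (∑ x, ∑ y, choiPair (W x y) (choi (G x y))).re ≤
      minTraceOf (jointChoi F W) := by
  have hY : (0 : ℝ) < Fintype.card Y := by exact_mod_cast Fintype.card_pos
  have hB : (0 : ℝ) < Fintype.card B₁ := by exact_mod_cast Fintype.card_pos
  let w : X → Op B₀ := fun x => traceSnd (∑ y, W x y)
  have hw : ∀ x, (w x).IsHermitian := by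
    intro x
    rw [Matrix.IsHermitian, ← traceSnd_conjTranspose, Matrix.conjTranspose_sum]
    simp only [(hW x _).eq, w]
  -- Summing $Z_x\otimes I$ over $y$ and tracing out $B_1$ gives $nZ_x$. Hence $Z_x=t-w_x/n$ cancels
  -- the marginal $w_x$ and leaves $tn\cdot 1$.
  let n : ℝ := Fintype.card Y * Fintype.card B₁
  have hn : 0 < n := mul_pos hY hB
  let U : X → Y → Op (B₀ × B₁) := fun x y => W x y - ((n⁻¹ : ℝ) : ℂ) • (w x ⊗ₖ (1 : Op B₁))
  have hreal : ∀ {m : Type _} (c : ℝ) {H : Op m}, H.IsHermitian → ((c : ℂ) • H).IsHermitian := by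
    intro m c H hH
    exact IsSelfAdjoint.smul (Complex.conj_ofReal c) hH
  have hU : ∀ x y, (U x y).IsHermitian := by
    intro x y
    refine (hW x y).sub (IsSelfAdjoint.smul (Complex.conj_ofReal _) ?_)
    exact isHermitian_kronecker_one (hw x)
  choose c hc hcU using fun x y => (hU x y).neg.exists_smul_one_sub_posSemidef
  -- Large enough to make every shifted operator positive; the summand 1 keeps $t>0$, so that the
  -- marginal can be rescaled to the identity.
  let t : ℝ := 1 + ∑ x, ∑ y, c x y
  have ht : ∀ x y, c x y ≤ t := by
    intro x y
    have h1 := Finset.single_le_sum (f := fun y => c x y) (fun y _ => hc x y) (Finset.mem_univ y)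
    have h2 := Finset.single_le_sum (f := fun x => ∑ y, c x y)
      (fun x _ => Finset.sum_nonneg fun y _ => hc x y) (Finset.mem_univ x)
    exact (h1.trans h2).trans (le_add_of_nonneg_left zero_le_one)
  have ht0 : 0 < t := by
    have : 0 ≤ ∑ x, ∑ y, c x y :=
      Finset.sum_nonneg fun x _ => Finset.sum_nonneg fun y _ => hc x y
    linarith
  let Z : X → Op B₀ := fun x => (t : ℂ) • 1 - ((n⁻¹ : ℝ) : ℂ) • w x
  have hZ : ∀ x, (Z x).IsHermitian := fun x =>
    (hreal t Matrix.isHermitian_one).sub (hreal _ (hw x))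
  let V : X → Y → Op (B₀ × B₁) := W + fun x _ => Z x ⊗ₖ (1 : Op B₁)
  have hVU : ∀ x y, V x y = U x y + (t : ℂ) • 1 := by
    intro x y
    have : Z x ⊗ₖ (1 : Op B₁) = (t : ℂ) • 1 - ((n⁻¹ : ℝ) : ℂ) • (w x ⊗ₖ (1 : Op B₁)) := by
      rw [← Matrix.one_kronecker_one, ← Matrix.smul_kronecker, ← Matrix.smul_kronecker]
      ext ⟨b, k⟩ ⟨b', k'⟩
      simp only [Z, Matrix.kronecker_apply, Matrix.sub_apply, sub_mul]
    simp only [V, U, Pi.add_apply, this]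
    abel
  have hV : ∀ x y, (V x y).PosSemidef := by
    intro x y
    have h1 : (0 : ℂ) ≤ ((t - c x y : ℝ) : ℂ) := by exact_mod_cast sub_nonneg.2 (ht x y)
    have h2 := (hcU x y).add ((Matrix.PosSemidef.one (n := B₀ × B₁) (R := ℂ)).smul h1)
    convert h2 using 1
    rw [hVU]
    push_cast
    rw [sub_smul]
    abel
  have hVtr : ∀ x, traceSnd (∑ y, V x y) = ((t * n : ℝ) : ℂ) • 1 := by
    intro x
    have hn' : (n : ℂ) ≠ 0 := by exact_mod_cast hn.ne'
    have hn2 : (n : ℂ) = Fintype.card Y * Fintype.card B₁ := by simp [n]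
    simp only [V, Pi.add_apply, Finset.sum_add_distrib, traceSnd_add, Finset.sum_const,
      Finset.card_univ]
    rw [← Nat.cast_smul_eq_nsmul ℂ, traceSnd_smul, traceSnd_kronecker_one, smul_smul, ← hn2,
      smul_sub, smul_smul, smul_smul]
    push_cast
    rw [mul_inv_cancel₀ hn', one_smul, mul_comm]
    simp [w]
  have hl : 0 < t * n := mul_pos ht0 hn
  have hinv : (0 : ℂ) ≤ (((t * n)⁻¹ : ℝ) : ℂ) := by exact_mod_cast (inv_pos.2 hl).le
  have h1 := h ((((t * n)⁻¹ : ℝ) : ℂ) • V) (fun x y => (hV x y).smul hinv) (by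
    intro x
    simp only [Pi.smul_apply]
    rw [← Finset.smul_sum, traceSnd_smul, hVtr, smul_smul, ← Complex.ofReal_mul,
      inv_mul_cancel₀ hl.ne', Complex.ofReal_one, one_smul])
  rw [jointChoi_smul, minTraceOf_smul (jointChoi_isHermitian hF fun x y => (hV x y).1)
    (inv_pos.2 hl)] at h1
  simp only [Pi.smul_apply, choiPair_smul, ← Finset.mul_sum, Complex.re_ofReal_mul] at h1
  rw [mul_left_comm, mul_le_mul_iff_right₀ (inv_pos.2 hl)] at h1
  -- The shift costs at most $d_{A_0}\sum{\rm Tr}\,Z_x$ here and contributes exactly that amount to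
  -- the pairing in `h3`, so it cancels.
  have h2 : minTraceOf (jointChoi F V) ≤ minTraceOf (jointChoi F W) +
      Fintype.card A₀ * (∑ x, (Z x).trace).re := by
    have hZ1 : ∀ x (_ : Y), (Z x ⊗ₖ (1 : Op B₁)).IsHermitian := fun x _ =>
      isHermitian_kronecker_one (hZ x)
    rw [jointChoi_add]
    exact (minTraceOf_add_le (jointChoi_isHermitian hF hW) (jointChoi_isHermitian hF hZ1)).trans
      (add_le_add_right (minTraceOf_jointChoi_kronecker_one_le hF hF' hZ) _)
  have h3 : ∑ x, ∑ y, choiPair (V x y) (choi (G x y)) =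
      ∑ x, ∑ y, choiPair (W x y) (choi (G x y)) + ∑ x, (Z x).trace := by
    simp only [V, Pi.add_apply, choiPair_add, Finset.sum_add_distrib, choiPair_sum_right,
      choiPair_kronecker_one (hG' _)]
  rw [h3, Complex.add_re, mul_add] at h1
  linarith

end Shift

/-! ### Hermitian parts, dominated functionals and the superchannels they represent. -/

/-- The Hermitian part of an operator. -/
def hermPart {n : Type*} (Z : Op n) : Op n := (2⁻¹ : ℂ) • (Z + Z.conjTranspose)

theorem hermPart_isHermitian {n : Type*} (Z : Op n) : (hermPart Z).IsHermitian :=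
  IsSelfAdjoint.smul (by simp [IsSelfAdjoint]) (Matrix.isHermitian_add_transpose_self Z)

theorem hermPart_of_isHermitian {n : Type*} {Z : Op n} (h : Z.IsHermitian) : hermPart Z = Z := by
  rw [hermPart, h.eq, ← two_smul ℂ Z, smul_smul, inv_mul_cancel₀ two_ne_zero, one_smul]

theorem hermPart_add {n : Type*} (Z Z' : Op n) : hermPart (Z + Z') = hermPart Z + hermPart Z' := by
  simp only [hermPart, Matrix.conjTranspose_add, ← smul_add]
  congr 1
  abel

theorem hermPart_real_smul {n : Type*} (c : ℝ) (Z : Op n) :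
    hermPart (c • Z) = (c : ℂ) • hermPart Z := by
  ext i j
  simp [hermPart]
  ring

theorem hermPart_trace_re {n : Type*} [Fintype n] (Z : Op n) :
    (hermPart Z).trace.re = Z.trace.re := by
  have h : (2⁻¹ : ℂ) = ((2⁻¹ : ℝ) : ℂ) := by simp
  rw [hermPart, Matrix.trace_smul, Matrix.trace_add, Matrix.trace_conjTranspose, smul_eq_mul, h,
    Complex.re_ofReal_mul, Complex.add_re, Complex.star_def, Complex.conj_re]
  ring

section Functional

variable {A₀ A₁ B₀ B₁ X Y : Type*} [Fintype A₀] [DecidableEq A₀] [Fintype A₁] [DecidableEq A₁]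
  [Fintype B₀] [DecidableEq B₀] [Fintype B₁] [DecidableEq B₁] [Fintype X] [Fintype Y]

theorem IsBalanced.conjTranspose {γ : Op ((A₀ × B₀) × A₁)} (h : IsBalanced γ) :
    IsBalanced γ.conjTranspose := by
  have hfst : traceFst (traceSnd γ).conjTranspose = (traceFst (traceSnd γ)).conjTranspose := by
    ext a b
    simp [traceFst_apply]
  have hu : (uniformState A₀).conjTranspose = uniformState A₀ := by
    ext i j
    simp [uniformState, Matrix.one_apply, eq_comm]
    split_ifs <;> simp
  rw [IsBalanced, traceSnd_conjTranspose, hfst]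
  conv_lhs => rw [h]
  rw [Matrix.conjTranspose_kronecker, hu]

theorem ampliate_hermPart (γ : Op ((A₀ × B₀) × A₁)) :
    ampliate B₁ (hermPart γ) = hermPart (ampliate B₁ γ) := by
  have h : ampliate B₁ γ.conjTranspose = (ampliate B₁ γ).conjTranspose := by
    ext p q
    simp only [Matrix.conjTranspose_apply, ampliate_apply, star_mul',
      (Matrix.isHermitian_one (n := B₁) (α := ℂ)).apply]
  rw [hermPart, map_smul, map_add, h, hermPart]

/-- A real functional dominated by the minimal trace. -/
structure DominatedFunctional (g : Op ((A₀ × B₀) × (A₁ × B₁)) →ₗ[ℝ] ℝ) : Prop where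
  le : ∀ Z, g Z ≤ minTraceOf (hermPart Z)

namespace DominatedFunctional

variable {g : Op ((A₀ × B₀) × (A₁ × B₁)) →ₗ[ℝ] ℝ}

theorem le_of_dominates [Nonempty B₁] (hg : DominatedFunctional g)
    {Z : Op ((A₀ × B₀) × (A₁ × B₁))} {γ : Op ((A₀ × B₀) × A₁)} (h : Dominates γ (hermPart Z)) :
    g Z ≤ γ.trace.re := (hg.le Z).trans h.minTraceOf_le

/-- The zero operator is balanced and dominates $-Z$, whence $g(-Z)\le0$. -/
theorem nonneg [Nonempty B₁] (hg : DominatedFunctional g)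
    {Z : Op ((A₀ × B₀) × (A₁ × B₁))} (hZ : (hermPart Z).PosSemidef) : 0 ≤ g Z := by
  have h : Dominates (0 : Op ((A₀ × B₀) × A₁)) (hermPart (-Z)) := by
    have e : hermPart (-Z) = -hermPart Z := by
      have := hermPart_real_smul (-1) Z
      simpa using this
    refine ⟨Matrix.isHermitian_zero, ?_, ?_⟩
    · rw [e, map_zero, zero_sub, neg_neg]
      exact hZ
    · ext i j
      simp [traceSnd, traceFst_apply]
  have h1 := hg.le_of_dominates h
  simp only [map_neg, Matrix.trace_zero, Complex.zero_re] at h1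
  linarith

theorem eq_zero [Nonempty B₁] (hg : DominatedFunctional g)
    {Z : Op ((A₀ × B₀) × (A₁ × B₁))} (hZ : hermPart Z = 0) : g Z = 0 := by
  refine le_antisymm ?_ (hg.nonneg (by rw [hZ]; exact .zero))
  have e : hermPart (-Z) = 0 := by
    have := hermPart_real_smul (-1) Z
    simpa [hZ] using this
  have := hg.nonneg (Z := -Z) (by rw [e]; exact .zero)
  rw [map_neg] at this
  linarith

/-- After passing to Hermitian parts, $\gamma$ is feasible for its own ampliation, which gives one
inequality; balance is a linear condition, so $-\gamma$ gives the other. -/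
theorem ampliate_eq [Nonempty B₁] (hg : DominatedFunctional g)
    {γ : Op ((A₀ × B₀) × A₁)} (hγ : IsBalanced γ) : g (ampliate B₁ γ) = γ.trace.re := by
  have key : ∀ {γ : Op ((A₀ × B₀) × A₁)}, IsBalanced γ → g (ampliate B₁ γ) ≤ γ.trace.re := by
    intro γ hγ
    rw [← hermPart_trace_re]
    refine hg.le_of_dominates ⟨hermPart_isHermitian γ, ?_, (hγ.add hγ.conjTranspose).smul _⟩
    rw [ampliate_hermPart, sub_self]
    exact .zero
  refine le_antisymm (key hγ) ?_
  have h := key (hγ.smul (-1))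
  simp only [neg_smul, one_smul, map_neg, Matrix.trace_neg, Complex.neg_re] at h
  linarith

/-- The complex-linear extension. -/
def complexify (g : Op ((A₀ × B₀) × (A₁ × B₁)) →ₗ[ℝ] ℝ) :
    Op ((A₀ × B₀) × (A₁ × B₁)) →ₗ[ℂ] ℂ :=
  Module.Dual.extendRCLike (𝕜 := ℂ) g

theorem complexify_apply (g : Op ((A₀ × B₀) × (A₁ × B₁)) →ₗ[ℝ] ℝ)
    (Z : Op ((A₀ × B₀) × (A₁ × B₁))) :
    complexify g Z = (g Z : ℂ) - Complex.I * (g (Complex.I • Z) : ℂ) :=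
  Module.Dual.extendRCLike_apply g Z

theorem complexify_re (g : Op ((A₀ × B₀) × (A₁ × B₁)) →ₗ[ℝ] ℝ)
    (Z : Op ((A₀ × B₀) × (A₁ × B₁))) : (complexify g Z).re = g Z := by
  simp [complexify_apply]

/-- By `eq_zero`, $g$ ignores anti-Hermitian operators, in particular $Z-Z^*$ and $i(Z+Z^*)$. -/
theorem complexify_conjTranspose [Nonempty B₁] (hg : DominatedFunctional g)
    (Z : Op ((A₀ × B₀) × (A₁ × B₁))) :
    complexify g Z.conjTranspose = star (complexify g Z) := by
  have h1 : g (Z - Z.conjTranspose) = 0 := hg.eq_zero (by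
    ext i j
    simp [hermPart])
  have h2 : g (Complex.I • (Z + Z.conjTranspose)) = 0 := hg.eq_zero (by
    ext i j
    simp [hermPart])
  rw [map_sub] at h1
  rw [smul_add, map_add] at h2
  rw [complexify_apply, complexify_apply, ← sub_eq_zero.1 h1, eq_neg_of_add_eq_zero_right h2]
  simp

theorem complexify_nonneg [Nonempty B₁] (hg : DominatedFunctional g)
    {Z : Op ((A₀ × B₀) × (A₁ × B₁))} (hZ : Z.PosSemidef) : 0 ≤ complexify g Z := by
  have h := hg.complexify_conjTranspose Z
  rw [hZ.1.eq] at h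
  rw [Complex.le_def]
  refine ⟨?_, (Complex.conj_eq_iff_im.1 h.symm).symm⟩
  rw [complexify_re]
  exact hg.nonneg (by rwa [hermPart_of_isHermitian hZ.1])

theorem complexify_ampliate [Nonempty B₁] (hg : DominatedFunctional g)
    {γ : Op ((A₀ × B₀) × A₁)} (hγ : IsBalanced γ) :
    complexify g (ampliate B₁ γ) = γ.trace := by
  rw [complexify_apply, ← map_smul, hg.ampliate_eq hγ, hg.ampliate_eq (hγ.smul _)]
  apply Complex.ext <;> simp [Matrix.trace_smul]

/-- The superchannel represented by a dominated functional. -/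
def toSuperMap (g : Op ((A₀ × B₀) × (A₁ × B₁)) →ₗ[ℝ] ℝ) : SuperMap A₀ A₁ B₀ B₁ where
  toFun Ω := ofChoi (Matrix.of fun s t => (Fintype.card A₀ : ℂ)⁻¹ * complexify g
    ((choi Ω ⊗ₖ Matrix.single s t (1 : ℂ)).submatrix
      (Equiv.prodProdProdComm A₀ B₀ A₁ B₁) (Equiv.prodProdProdComm A₀ B₀ A₁ B₁)))
  map_add' Ω Ω' := by
    apply choi_injective
    ext s t
    simp only [choi_add, choi_ofChoi, Matrix.of_apply, Matrix.add_apply, Matrix.add_kronecker,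
      ← mul_add, ← map_add]
    rfl
  map_smul' c Ω := by
    apply choi_injective
    ext s t
    simp only [choi_smul, choi_ofChoi, Matrix.of_apply, Matrix.smul_apply, RingHom.id_apply,
      Matrix.smul_kronecker, smul_eq_mul]
    rw [mul_left_comm, ← smul_eq_mul c, ← map_smul]
    rfl

theorem choi_toSuperMap (g : Op ((A₀ × B₀) × (A₁ × B₁)) →ₗ[ℝ] ℝ) (Ω : LMap A₀ A₁)
    (s t : B₀ × B₁) : choi (toSuperMap g Ω) s t = (Fintype.card A₀ : ℂ)⁻¹ * complexify g
      ((choi Ω ⊗ₖ Matrix.single s t (1 : ℂ)).submatrix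
        (Equiv.prodProdProdComm A₀ B₀ A₁ B₁) (Equiv.prodProdProdComm A₀ B₀ A₁ B₁)) := by
  rw [toSuperMap, LinearMap.coe_mk, AddHom.coe_mk, choi_ofChoi]
  rfl

theorem choiPair_toSuperMap [Nonempty A₀] (g : Op ((A₀ × B₀) × (A₁ × B₁)) →ₗ[ℝ] ℝ)
    (Ω : LMap A₀ A₁) (H : Op (B₀ × B₁)) :
    Fintype.card A₀ * choiPair H (choi (toSuperMap g Ω)) = complexify g
      ((choi Ω ⊗ₖ H).submatrix
        (Equiv.prodProdProdComm A₀ B₀ A₁ B₁) (Equiv.prodProdProdComm A₀ B₀ A₁ B₁)) := by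
  have hA : (Fintype.card A₀ : ℂ) ≠ 0 := by exact_mod_cast Fintype.card_ne_zero
  have e : (choi Ω ⊗ₖ H).submatrix
      (Equiv.prodProdProdComm A₀ B₀ A₁ B₁) (Equiv.prodProdProdComm A₀ B₀ A₁ B₁) =
      ∑ s, ∑ t, H s t • (choi Ω ⊗ₖ Matrix.single s t (1 : ℂ)).submatrix
        (Equiv.prodProdProdComm A₀ B₀ A₁ B₁) (Equiv.prodProdProdComm A₀ B₀ A₁ B₁) := by
    ext ⟨⟨a, b⟩, k, l⟩ ⟨⟨a', b'⟩, k', l'⟩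
    simp [Matrix.sum_apply, Matrix.single_apply, ite_and, mul_comm]
  rw [e]
  simp only [map_sum, map_smul, smul_eq_mul, choiPair, Finset.mul_sum, choi_toSuperMap]
  refine Finset.sum_congr rfl fun s _ => Finset.sum_congr rfl fun t _ => ?_
  field_simp

/-- Positivity of $g$ makes its matrix of values on matrix units positive, and this is the Choi
matrix of the supermap up to scale and reordering. For TP $\Omega$, tracing out $B_1$ evaluates $g$
on the ampliation of a balanced operator, where it is the trace. -/
theorem isSuperchannel_toSuperMap [Nonempty A₀] [Nonempty B₁] (hg : DominatedFunctional g) :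
    IsSuperchannel (toSuperMap g) := by
  have hA : (Fintype.card A₀ : ℂ) ≠ 0 := by exact_mod_cast Fintype.card_ne_zero
  constructor
  · apply isCompletelyCPP_of_superChoi
    let J : Op ((A₀ × B₀) × (A₁ × B₁)) :=
      Matrix.of fun p q => complexify g (Matrix.single p q 1)
    have hJ : J.PosSemidef := by
      refine Matrix.PosSemidef.of_dotProduct_mulVec_nonneg ?_ fun v => ?_
      · ext p q
        simp only [J, Matrix.conjTranspose_apply, Matrix.of_apply]
        rw [← hg.complexify_conjTranspose, Matrix.conjTranspose_single, star_one]
      · have h := hg.complexify_nonneg (Matrix.posSemidef_vecMulVec_star_self v)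
        -- Expanding the rank-one operator in matrix units turns the value of the functional into
        -- the quadratic form of `J` at `v`.
        rw [sum_single_smul (Matrix.vecMulVec (star v) v)] at h
        simp only [map_sum, map_smul, Matrix.vecMulVec_apply, smul_eq_mul] at h
        convert h using 1
        simp only [dotProduct, Matrix.mulVec, Finset.mul_sum, J, Matrix.of_apply]
        refine Finset.sum_congr rfl fun s _ => Finset.sum_congr rfl fun t _ => ?_
        ring
    have hc : (0 : ℂ) ≤ (Fintype.card A₀ : ℂ)⁻¹ := by
      rw [← Complex.ofReal_natCast, ← Complex.ofReal_inv]
      exact_mod_cast (by positivity : (0 : ℝ) ≤ (Fintype.card A₀ : ℝ)⁻¹)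
    convert (hJ.smul hc).submatrix (Equiv.prodProdProdComm A₀ B₀ A₁ B₁).symm using 1
    ext ⟨p, s⟩ ⟨q, t⟩
    simp only [superChoi, Matrix.of_apply, choi_toSuperMap, choi_ofChoi, Matrix.submatrix_apply,
      Matrix.smul_apply, smul_eq_mul, J]
    congr 2
    ext i j
    rw [Matrix.submatrix_apply, Matrix.single_kronecker_single, mul_one, Matrix.single_apply,
      Matrix.single_apply]
    simp only [Equiv.symm_apply_eq]
  · intro Ω hΩ
    rw [isTP_iff] at hΩ ⊢
    ext b b'
    let γ : Op ((A₀ × B₀) × A₁) := Matrix.of fun p q =>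
      choi Ω (p.1.1, p.2) (q.1.1, q.2) * Matrix.single b b' (1 : ℂ) p.1.2 q.1.2
    have hsnd : traceSnd γ =
        uniformState A₀ ⊗ₖ ((Fintype.card A₀ : ℂ) • Matrix.single b b' (1 : ℂ)) := by
      ext ⟨a, c⟩ ⟨a', c'⟩
      have h1 : ∑ k, choi Ω (a, k) (a', k) = (1 : Op A₀) a a' := by
        rw [← hΩ]; rfl
      simp only [traceSnd, γ, Matrix.of_apply, ← Finset.sum_mul, h1, uniformState,
        Matrix.kronecker_apply, Matrix.smul_apply, smul_eq_mul]
      field_simp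
    obtain ⟨hb, htr⟩ := isBalanced_of_eq hsnd
    have hamp : ∑ k, (choi Ω ⊗ₖ Matrix.single (b, k) (b', k) (1 : ℂ)).submatrix
        (Equiv.prodProdProdComm A₀ B₀ A₁ B₁) (Equiv.prodProdProdComm A₀ B₀ A₁ B₁) =
        ampliate B₁ γ := by
      ext ⟨⟨a, c⟩, k, l⟩ ⟨⟨a', c'⟩, k', l'⟩
      simp only [Matrix.sum_apply, Matrix.submatrix_apply, Equiv.prodProdProdComm_apply,
        Matrix.kronecker_apply, ampliate_apply, γ, Matrix.of_apply, Matrix.single_apply,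
        Prod.mk.injEq, Matrix.one_apply, ← Finset.mul_sum, mul_assoc]
      congr 1
      rw [Finset.sum_eq_single l (by intros; simp_all) (by simp)]
      split_ifs <;> simp_all
    simp only [traceSnd, Matrix.of_apply, choi_toSuperMap, ← Finset.mul_sum]
    rw [← map_sum, hamp, hg.complexify_ampliate hb, htr, Matrix.trace_smul, smul_eq_mul,
      inv_mul_cancel_left₀ hA]
    by_cases hbb : b = b'
    · subst hbb; simp
    · simp [hbb, Matrix.trace_single_eq_of_ne]

end DominatedFunctional

/-- Hahn–Banach along $W\mapsto\sum F_{y|x}\otimes W_{xy}$. Composing the sublinear bound with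
`hermPart` defines it on all operators without changing it on the Hermitian range. -/
theorem exists_dominatedFunctional [Nonempty A₀] [Nonempty B₁]
    {F : X → Y → LMap A₀ A₁} {G : X → Y → LMap B₀ B₁} (hF : ∀ x y, (choi (F x y)).PosSemidef)
    (h : ∀ W : X → Y → Op (B₀ × B₁), (∀ x y, (W x y).IsHermitian) →
      Fintype.card A₀ * (∑ x, ∑ y, choiPair (W x y) (choi (G x y))).re ≤
        minTraceOf (jointChoi F W)) :
    ∃ g : Op ((A₀ × B₀) × (A₁ × B₁)) →ₗ[ℝ] ℝ, DominatedFunctional g ∧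
      ∀ W : X → Y → Op (B₀ × B₁), (∀ x y, (W x y).IsHermitian) →
        g (jointChoi F W) =
          Fintype.card A₀ * (∑ x, ∑ y, choiPair (W x y) (choi (G x y))).re := by
  let M : (X → Y → selfAdjoint (Op (B₀ × B₁))) →ₗ[ℝ] Op ((A₀ × B₀) × (A₁ × B₁)) :=
    { toFun W := jointChoi F fun x y => (W x y : Op (B₀ × B₁))
      map_add' W W' := jointChoi_add F _ _
      map_smul' c W := by
        have := jointChoi_smul F (c : ℂ) fun x y => (W x y : Op (B₀ × B₁))
        ext p q
        simpa [jointChoi_apply] using congrFun (congrFun this p) q }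
  let ψ : (X → Y → selfAdjoint (Op (B₀ × B₁))) →ₗ[ℝ] ℝ :=
    { toFun W := Fintype.card A₀ *
        (∑ x, ∑ y, choiPair (W x y : Op (B₀ × B₁)) (choi (G x y))).re
      map_add' W W' := by
        simp [choiPair_add, Finset.sum_add_distrib, mul_add]
      map_smul' c W := by
        have : ∀ x y, choiPair ((c • W) x y : Op (B₀ × B₁)) (choi (G x y)) =
            (c : ℂ) * choiPair (W x y : Op (B₀ × B₁)) (choi (G x y)) := by
          intro x y
          rw [← choiPair_smul]
          congr 1
        simp only [this, ← Finset.mul_sum, Complex.re_ofReal_mul, RingHom.id_apply, smul_eq_mul]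
        ring }
  obtain ⟨g, hg, hN⟩ := LinearMap.exists_comp_eq_of_le_sublinear M ψ
    (fun Z => minTraceOf (hermPart Z))
    (fun c hc Z => by rw [hermPart_real_smul, minTraceOf_smul (hermPart_isHermitian Z) hc])
    (fun Z Z' => by
      rw [hermPart_add]
      exact minTraceOf_add_le (hermPart_isHermitian Z) (hermPart_isHermitian Z'))
    (fun W => by
      have hW : ∀ x y, (W x y : Op (B₀ × B₁)).IsHermitian := fun x y => (W x y).2
      have := h (fun x y => (W x y : Op (B₀ × B₁))) hW
      rwa [← hermPart_of_isHermitian (jointChoi_isHermitian hF hW)] at this)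
  exact ⟨g, ⟨hN⟩, fun W hW => hg fun x y => ⟨W x y, hW x y⟩⟩

/-- Testing with $H=(C-D)^T$ turns the difference of pairings into the squared Frobenius norm of
$C-D$. -/
theorem eq_of_re_choiPair_eq {n : Type*} [Fintype n] {C D : Op n} (hC : C.IsHermitian)
    (hD : D.IsHermitian) (h : ∀ H : Op n, H.IsHermitian → (choiPair H C).re = (choiPair H D).re) :
    C = D := by
  have hK := hC.sub hD
  have h1 := h (C - D).transpose hK.transpose
  have h2 : ∑ p, ∑ q, Complex.normSq ((C - D) p q) = 0 := by
    have e : (choiPair (C - D).transpose C - choiPair (C - D).transpose D).re =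
        ∑ p, ∑ q, Complex.normSq ((C - D) p q) := by
      simp only [choiPair, ← Finset.sum_sub_distrib, ← mul_sub, Complex.re_sum]
      refine Finset.sum_congr rfl fun p _ => Finset.sum_congr rfl fun q _ => ?_
      rw [Matrix.transpose_apply, ← hK.apply q p, Complex.star_def, ← Matrix.sub_apply,
        ← Complex.normSq_eq_conj_mul_self, Complex.ofReal_re]
    rw [← e, Complex.sub_re, h1, sub_self]
  ext p q
  have h3 := (Finset.sum_eq_zero_iff_of_nonneg fun p _ =>
    Finset.sum_nonneg fun q _ => Complex.normSq_nonneg _).1 h2 p (Finset.mem_univ p)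
  have h4 := (Finset.sum_eq_zero_iff_of_nonneg fun q _ =>
    Complex.normSq_nonneg _).1 h3 q (Finset.mem_univ q)
  exact sub_eq_zero.1 (Complex.normSq_eq_zero.1 h4)

/-- Families of CP maps related by all pairing inequalities are related by a superchannel. -/
theorem exists_superchannel_of_le [DecidableEq X] [DecidableEq Y] [Nonempty A₀] [Nonempty B₁]
    {F : X → Y → LMap A₀ A₁} {G : X → Y → LMap B₀ B₁} (hF : ∀ x y, (choi (F x y)).PosSemidef)
    (hG : ∀ x y, (choi (G x y)).PosSemidef)
    (h : ∀ W : X → Y → Op (B₀ × B₁), (∀ x y, (W x y).IsHermitian) →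
      Fintype.card A₀ * (∑ x, ∑ y, choiPair (W x y) (choi (G x y))).re ≤
        minTraceOf (jointChoi F W)) :
    ∃ Θ : SuperMap A₀ A₁ B₀ B₁, IsSuperchannel Θ ∧ ∀ x y, G x y = Θ (F x y) := by
  obtain ⟨g, hg, hgW⟩ := exists_dominatedFunctional hF h
  have hA : (Fintype.card A₀ : ℝ) ≠ 0 := by exact_mod_cast Fintype.card_ne_zero
  have hΘ := hg.isSuperchannel_toSuperMap
  refine ⟨_, hΘ, fun x y => choi_injective ?_⟩
  have hΘF : (choi (DominatedFunctional.toSuperMap g (F x y))).IsHermitian := by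
    have hJ := superChoi_posSemidef hΘ.1
    ext s t
    simp only [Matrix.conjTranspose_apply, choi_supermap_apply, star_sum, star_mul',
      (hF x y).1.apply, hJ.1.apply]
    rw [Finset.sum_comm]
  refine eq_of_re_choiPair_eq (hG x y).1 hΘF fun H hH => ?_
  -- A family supported at the single pair $(x,y)$ isolates one reduction.
  have h1 := hgW (fun x' y' => if x' = x ∧ y' = y then H else 0) (by
    intro x' y'
    split_ifs
    exacts [hH, Matrix.isHermitian_zero])
  have e1 : jointChoi F (fun x' y' => if x' = x ∧ y' = y then H else 0) =
      (choi (F x y) ⊗ₖ H).submatrix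
        (Equiv.prodProdProdComm A₀ B₀ A₁ B₁) (Equiv.prodProdProdComm A₀ B₀ A₁ B₁) := by
    rw [jointChoi, Finset.sum_eq_single x (by intro z _ hz; simp [hz]) (by simp),
      Finset.sum_eq_single y (by intro z _ hz; simp [hz]) (by simp)]
    simp
  have e2 : ∑ x', ∑ y', choiPair (if x' = x ∧ y' = y then H else 0) (choi (G x' y')) =
      choiPair H (choi (G x y)) := by
    rw [Finset.sum_eq_single x (by intro z _ hz; simp [hz, choiPair]) (by simp),
      Finset.sum_eq_single y (by intro z _ hz; simp [hz, choiPair]) (by simp)]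
    simp
  rw [e1, e2, ← DominatedFunctional.complexify_re, ← DominatedFunctional.choiPair_toSuperMap,
    ← Complex.ofReal_natCast, Complex.re_ofReal_mul] at h1
  exact (mul_left_cancel₀ hA h1).symm

end Functional

end QMaj

/-! ### The characterization of quantum majorization. -/

theorem theorem5 {R₀ R₁ A₀ A₁ B₀ B₁ X Y : Type*}
    [Fintype R₀] [DecidableEq R₀] [Nonempty R₀] [Fintype R₁] [DecidableEq R₁] [Nonempty R₁]
    [Fintype A₀] [DecidableEq A₀] [Nonempty A₀] [Fintype A₁] [DecidableEq A₁] [Nonempty A₁]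
    [Fintype B₀] [DecidableEq B₀] [Nonempty B₀] [Fintype B₁] [DecidableEq B₁] [Nonempty B₁]
    [Fintype X] [DecidableEq X] [Fintype Y] [DecidableEq Y]
    (φ : X → R₀ → ℂ) (hφ : QMaj.IsRankOneBasis φ)
    (E : Y → QMaj.Op R₁) (hE : QMaj.IsBasisPOVM E)
    (Φ : QMaj.LMap (R₀ × A₀) (R₁ × A₁)) (hΦ : QMaj.IsChannel Φ)
    (Ψ : QMaj.LMap (R₀ × B₀) (R₁ × B₁)) (hΨ : QMaj.IsChannel Ψ) :
    QMaj.QuantumMajorizes Φ Ψ ↔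
      ∀ Λ : X → Y → QMaj.LMap B₀ B₁, QMaj.InCStar Λ →
        QMaj.Hminext (QMaj.pairing (QMaj.reduction φ E Φ) Λ) ≤
          QMaj.Hminext (QMaj.pairing (QMaj.reduction φ E Ψ) Λ) := by
  have hX : Nonempty X := by
    by_contra hX
    rw [not_nonempty_iff] at hX
    have := hφ.span_complex
    rw [Set.range_eq_empty, Submodule.span_empty] at this
    exact bot_ne_top this
  have hY : Nonempty Y := by
    by_contra hY
    rw [not_nonempty_iff] at hY
    have := hE.2.1
    simp at this
  have hF := QMaj.choi_reduction_posSemidef φ hE.1 hΦ.1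
  have hG := QMaj.choi_reduction_posSemidef φ hE.1 hΨ.1
  have hF' : ∀ x, QMaj.traceSnd (∑ y, QMaj.choi (QMaj.reduction φ E Φ x y)) = 1 := by
    intro x
    rw [← QMaj.choi_sum, ← QMaj.isTP_iff]
    exact QMaj.isTP_sum_reduction hφ.1 hE.2.1 hΦ.2 x
  have hG' : ∀ x, QMaj.traceSnd (∑ y, QMaj.choi (QMaj.reduction φ E Ψ x y)) = 1 := by
    intro x
    rw [← QMaj.choi_sum, ← QMaj.isTP_iff]
    exact QMaj.isTP_sum_reduction hφ.1 hE.2.1 hΨ.2 x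
  have hiff : ∀ Λ : X → Y → QMaj.LMap B₀ B₁, QMaj.InCStar Λ →
      (QMaj.Hminext (QMaj.pairing (QMaj.reduction φ E Φ) Λ) ≤
          QMaj.Hminext (QMaj.pairing (QMaj.reduction φ E Ψ) Λ) ↔
        QMaj.minTrace (QMaj.pairing (QMaj.reduction φ E Ψ) Λ) ≤
          QMaj.minTrace (QMaj.pairing (QMaj.reduction φ E Φ) Λ)) := fun Λ hΛ =>
    QMaj.Hminext_le_iff
      (QMaj.minTraceOf_nonneg (QMaj.normChoi_pairing_posSemidef hF hΛ.choi_posSemidef))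
      (QMaj.minTraceOf_nonneg (QMaj.normChoi_pairing_posSemidef hG hΛ.choi_posSemidef))
  constructor
  · rintro ⟨Θ, hΘ, rfl⟩ Λ hΛ
    rw [hiff Λ hΛ]
    have e : QMaj.reduction φ E (QMaj.applySecond Θ Φ) =
        fun x y => Θ (QMaj.reduction φ E Φ x y) := by
      funext x y
      exact QMaj.reduction_applySecond φ E Φ Θ x y
    rw [e]
    exact QMaj.minTrace_supermap_le hΘ hF hΛ.choi_posSemidef
  · intro h
    obtain ⟨Θ, hΘ, hΘF⟩ := QMaj.exists_superchannel_of_le hF hG fun W hW =>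
      QMaj.choiPair_le_of_isHermitian hF hF' hG' (fun V hV hV' => by
        have hΛ : QMaj.InCStar fun x y => QMaj.ofChoi (V x y) :=
          QMaj.inCStar_of_choi (by simpa only [QMaj.choi_ofChoi] using hV)
            (by simpa only [QMaj.choi_ofChoi] using hV')
        have := QMaj.choiPair_le_minTraceOf hF hG hΛ.choi_posSemidef ((hiff _ hΛ).1 (h _ hΛ))
        simpa only [QMaj.choi_ofChoi] using this) hW
    refine ⟨Θ, hΘ, QMaj.reduction_injective hφ hE.2.2.2 fun x y => ?_⟩
    rw [QMaj.reduction_applySecond, hΘF]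

end
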